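/- Fix a density $\lambda>0$, a path-loss exponent $\alpha>2$, an SINR threshold $\xi>0$, a normalized noise power $\sigma^2\ge 0$, a transmission probability $0<\rho\le 1$, and positive integers $M$ (number of resource blocks, RBs), $m_s$, $m_i$. A typical node is at the origin of $\mathbb{R}^2$, and the other nodes $X_1,X_2,\dots$ form a homogeneous Poisson point process of density $\lambda$. In a time slot every node, including the typical one, independently transmits with probability $\rho$ and receives otherwise; each transmitting node uses one of the $M$ RBs, chosen uniformly at random. The signal of node $i$ has fading power gain $h_i$ when it is the desired signal and $g_i$ when it is interference, where $h_i$ is Gamma distributed with shape and rate $m_s$ and $g_i$ is Gamma distributed with shape and rate $m_i$ (Nakagami-$m$ fading). Locations, transmission modes, RB choices and fading are independent of each other, and modes, RB choices and fading are independent across nodes. The SINR of node $i$ at the typical node is $$\Xi_i=\frac{|X_i|^{-\alpha}h_i}{\sum_{j}|X_j|^{-\alpha}g_j+\sigma^2},$$ where the sum is over all nodes $j\neq i$ that transmit over the same RB as node $i$. Let $S$ be the number of nodes $i$ that the typical node discovers over all RBs, i.e. such that the typical node is receiving, node $i$ is transmitting, and $\Xi_i>\xi$. Then $\mathbb{E}\{S\}<\infty$,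 the integrals below converge absolutely, and $$\mathbb{E}\{S\}=2\pi\lambda\rho(1-\rho)\sum_{k=0}^{m_s-1}\frac{(-m_s\xi)^k}{k!}\int_0^\infty r^{k\alpha+1}\left.\frac{d^k}{d\zeta^k}\exp\!\left(-\frac{\lambda\rho}{M}\pi\zeta^{2/\alpha}\Delta_i(m_i,\alpha)-\zeta\sigma^2\right)\right|_{\zeta=m_s\xi r^\alpha}dr,$$ where $\Delta_i(m_i,\alpha)=m_i^{-2/\alpha}\,\dfrac{\Gamma(1-\frac{2}{\alpha})\,\Gamma(m_i+\frac{2}{\alpha})}{\Gamma(m_i)}$. -/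

import Mathlib

open MeasureTheory ProbabilityTheory
open scoped ENNReal

noncomputable section

namespace PeerDiscovery

/-- The Euclidean plane. -/
abbrev Plane : Type := EuclideanSpace ℝ (Fin 2)

/-- Number of points of the configuration `x 0, x 1, x 2, …` that lie in `B`
(counted with multiplicity). -/
def count {E : Type*} (x : ℕ → E) (B : Set E) : ℕ∞ := {n | x n ∈ B}.encard

/-- The random points `X 0, X 1, …` form a Poisson point process with intensity measure `Λ`:
the number of points in a measurable set `B` of finite intensity is Poisson distributed with
mean `Λ B`, and the numbers of points in finitely many disjoint such sets are independent.
(The points are enumerated by `ℕ`, which is possible exactly when `Λ` has infinite mass.) -/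
structure IsPoissonProcess {Ω E : Type*} [MeasurableSpace Ω] [MeasurableSpace E]
    (X : ℕ → Ω → E) (Λ : Measure E) (P : Measure Ω) : Prop where
  measurable : ∀ n, Measurable (X n)
  count_law : ∀ B : Set E, MeasurableSet B → Λ B ≠ ∞ →
    HasLaw (fun ω => count (fun n => X n ω) B)
      ((poissonMeasure (Λ B).toNNReal).map (fun k : ℕ => (k : ℕ∞))) P
  count_indep : ∀ (m : ℕ) (B : Fin m → Set E), (∀ i, MeasurableSet (B i)) →
    (∀ i, Λ (B i) ≠ ∞) → Pairwise (fun i j => Disjoint (B i) (B j)) →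
    iIndepFun (fun i ω => count (fun n => X n ω) (B i)) P

/-- The random quantities of one time slot with `M` resource blocks. The typical node sits at the
origin; the other nodes are numbered `0, 1, 2, …`. -/
structure Slot (Ω : Type*) (M : ℕ) where
  /-- is the typical node in the transmitting mode? -/
  tx₀ : Ω → Bool
  /-- location of node `n` -/
  loc : ℕ → Ω → Plane
  /-- is node `n` in the transmitting mode? -/
  tx : ℕ → Ω → Bool
  /-- resource block chosen by node `n` (used only if the node transmits) -/
  rb : ℕ → Ω → Fin M
  /-- fading power gain of node `n` when its signal is the desired one -/
  h : ℕ → Ω → ℝ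
  /-- fading power gain of node `n` when its signal is interference -/
  g : ℕ → Ω → ℝ

namespace Slot

variable {Ω : Type*} {M : ℕ}

/-- All marks (mode, resource block, fading gains) of node `n`. -/
def mark (N : Slot Ω M) (n : ℕ) (ω : Ω) : (Bool × Fin M) × (ℝ × ℝ) :=
  ((N.tx n ω, N.rb n ω), (N.h n ω, N.g n ω))

/-- Probabilistic assumptions of the model: the nodes form a homogeneous Poisson point process of
density `lam` in the plane; every node, the typical one included, transmits with probability `ρ`;
resource blocks are uniform; the desired and interfering power gains have the normalized Gamma laws
of Nakagami fading with parameters `ms` and `mi`. Locations, modes, resource blocks and fading are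
independent, and the marks are independent across nodes. Nothing is assumed about the joint law of
the two gains `h n`, `g n` of one and the same node. -/
structure IsRandomHello [MeasurableSpace Ω] (N : Slot Ω M) (P : Measure Ω)
    (lam ρ : ℝ) (ms mi : ℕ) : Prop where
  measurable_tx₀ : Measurable N.tx₀
  measurable_mark : ∀ n, Measurable (N.mark n)
  loc_poisson : IsPoissonProcess N.loc (ENNReal.ofReal lam • (volume : Measure Plane)) P
  tx₀_law : P {ω | N.tx₀ ω = true} = ENNReal.ofReal ρ
  tx_law : ∀ n, P {ω | N.tx n ω = true} = ENNReal.ofReal ρ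
  rb_law : ∀ n b, P {ω | N.rb n ω = b} = (M : ℝ≥0∞)⁻¹
  h_law : ∀ n, HasLaw (N.h n) (gammaMeasure ms ms) P
  g_law : ∀ n, HasLaw (N.g n) (gammaMeasure mi mi) P
  indep_tx_rb : ∀ n, IndepFun (N.tx n) (N.rb n) P
  indep_fading : ∀ n,
    IndepFun (fun ω => (N.tx n ω, N.rb n ω)) (fun ω => (N.h n ω, N.g n ω)) P
  indep_nodes : iIndepFun N.mark P
  indep_tx₀ : IndepFun N.tx₀ (fun ω n => N.mark n ω) P
  indep_loc : IndepFun (fun ω n => N.loc n ω) (fun ω => (N.tx₀ ω, fun n => N.mark n ω)) P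

/-- Signal power received at the origin from a node at `x` with power gain `a`:
`|x| ^ (-α) * a`. -/
def power (α : ℝ) (x : Plane) (a : ℝ) : ℝ≥0∞ := ‖x‖ₑ ^ (-α) * ENNReal.ofReal a

open Classical in
/-- Total interference at the origin for the packet of node `i`: all other nodes that transmit
over the resource block of node `i` interfere. -/
def interference (N : Slot Ω M) (α : ℝ) (i : ℕ) (ω : Ω) : ℝ≥0∞ :=
  ∑' j, if j ≠ i ∧ N.tx j ω = true ∧ N.rb j ω = N.rb i ω
    then power α (N.loc j ω) (N.g j ω) else 0

/-- Received SINR at the typical node of the packet of node `i`, with noise power `σ ^ 2`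
(normalized by the transmit power). -/
def sinr (N : Slot Ω M) (α σ : ℝ) (i : ℕ) (ω : Ω) : ℝ≥0∞ :=
  power α (N.loc i ω) (N.h i ω) / (N.interference α i ω + ENNReal.ofReal (σ ^ 2))

/-- `S`, the number of nodes that the typical node discovers in the slot, over all resource blocks:
the typical node has to receive, the target node to transmit, and the SINR to exceed `ξ`. -/
def discovered (N : Slot Ω M) (α σ ξ : ℝ) (ω : Ω) : ℕ∞ :=
  {i | N.tx₀ ω = false ∧ N.tx i ω = true ∧ ENNReal.ofReal ξ < N.sinr α σ i ω}.encard

/-- The average number `𝔼 S` of discovered nodes. -/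
def meanDiscovered [MeasurableSpace Ω] (N : Slot Ω M) (P : Measure Ω) (α σ ξ : ℝ) : ℝ≥0∞ :=
  ∫⁻ ω, (N.discovered α σ ξ ω : ℝ≥0∞) ∂P

end Slot

/-- `Δᵢ(m, α) = m ^ (-2/α) Γ(1 - 2/α) Γ(m + 2/α) / Γ(m)`. -/
def DeltaI (m : ℕ) (α : ℝ) : ℝ :=
  (m : ℝ) ^ (-(2 / α)) * (Real.Gamma (1 - 2 / α) * Real.Gamma (m + 2 / α) / Real.Gamma m)

/-- The function of `ζ` that is differentiated: the Laplace-type exponential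
`exp (-(lam ρ / M) π ζ ^ (2/α) Δᵢ - ζ σ ^ 2)`. -/
def expTerm (lam ρ : ℝ) (M mi : ℕ) (α σ ζ : ℝ) : ℝ :=
  Real.exp (-(lam * ρ / M) * Real.pi * ζ ^ (2 / α) * DeltaI mi α - ζ * σ ^ 2)

/-- The integrand `r ^ (k α + 1) · (d^k/dζ^k) expTerm` at `ζ = ms ξ r ^ α`. -/
def integrand (lam ρ : ℝ) (M ms mi : ℕ) (α σ ξ : ℝ) (k : ℕ) (r : ℝ) : ℝ :=
  r ^ (k * α + 1) * iteratedDeriv k (expTerm lam ρ M mi α σ) (ms * ξ * r ^ α)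

end PeerDiscovery

end

noncomputable section

namespace PeerDiscovery

open Filter Topology

/-! Node `i` is discovered when the typical node receives (probability `1 - ρ`), node `i` transmits
on some block `b` (probability `ρ / M`), and its gain beats the threshold set by the interference
and the noise. By the Slivnyak–Mecke principle, summing over `i` the joint law of the location of
node `i` and the interference of all the others gives the product of the intensity measure and the
law `κ` of the total interference on `b` (`sum_map_loc_interf`). Hence `meanDiscovered_eq`: a
spatial integral of the decoding probability averaged over `κ`. Summing over the `M` blocks cancels
the `1 / M` of the desired node; the `1 / M` of the interferers stays in the exponent.

The law `κ` is known through its Laplace transform. For fixed locations the independent marks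
average out to a product of one-node transforms (`laplace_interfAt`). Written as `exp (-∑ u (X j))`,
this product is a functional of the unmarked Poisson process, to which `IsPoissonProcess.laplace`
applies. Mecke's formula is needed only for exponential functionals (`mecke_expNeg`), since Laplace
transforms at the integers determine finite measures (`measure_ext_of_laplace`). Values are kept in
`[0, ∞]`, the interference being finite only almost surely.

A Gamma variable of integer shape has the Erlang tail `exp (-x) ∑ x ^ k / k!`, here at `x = ζ W`
with `ζ = ms ξ r ^ α` and `W` interference plus noise. The mean of `W ^ k exp (-ζ W)` is `(-1) ^ k`
times the `k`-th derivative of `expTerm` (`iteratedDeriv_expTerm`). Polar coordinates give the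
radial integrals, and a Gaussian bound gives their convergence (`integrableOn_integrand`). -/

/-! ### The function `exp (-x)` on `[0, ∞]` -/

/-- The function `x ↦ exp (-x)` on `[0, ∞]`, with value `0` at `∞`. -/
def expNeg (x : ℝ≥0∞) : ℝ≥0∞ := EReal.exp (-(x : EReal))

/-- The inverse `v ↦ -log v` of `expNeg`. -/
def negLog (v : ℝ≥0∞) : ℝ≥0∞ := (-(ENNReal.log v)).toENNReal

@[simp] lemma expNeg_zero : expNeg 0 = 1 := by simp [expNeg]

@[simp] lemma expNeg_top : expNeg ∞ = 0 := by simp [expNeg]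

lemma expNeg_add (x y : ℝ≥0∞) : expNeg (x + y) = expNeg x * expNeg y := by
  rw [expNeg, expNeg, expNeg, ← EReal.exp_add, EReal.coe_ennreal_add,
    EReal.neg_add (by simp) (by simp), sub_eq_add_neg]

lemma expNeg_ofReal {x : ℝ} (hx : 0 ≤ x) :
    expNeg (ENNReal.ofReal x) = ENNReal.ofReal (Real.exp (-x)) := by
  rw [expNeg, EReal.coe_ennreal_ofReal, max_eq_left hx, ← EReal.coe_neg, EReal.exp_coe]

lemma continuous_expNeg : Continuous expNeg :=
  ENNReal.continuous_exp.comp (continuous_neg.comp continuous_coe_ennreal_ereal)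

@[fun_prop]
lemma measurable_expNeg : Measurable expNeg := continuous_expNeg.measurable

lemma expNeg_strictAnti : StrictAnti expNeg := fun x y h => by
  simpa [expNeg, EReal.neg_lt_neg_iff] using h

lemma expNeg_antitone : Antitone expNeg := expNeg_strictAnti.antitone

lemma expNeg_le_one (x : ℝ≥0∞) : expNeg x ≤ 1 := by
  simpa using expNeg_antitone (zero_le : 0 ≤ x)

lemma expNeg_ne_top (x : ℝ≥0∞) : expNeg x ≠ ∞ := ne_top_of_le_ne_top (by simp) (expNeg_le_one x)

@[simp] lemma expNeg_eq_zero {x : ℝ≥0∞} : expNeg x = 0 ↔ x = ∞ := by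
  rw [← expNeg_top, expNeg_strictAnti.injective.eq_iff]

lemma expNeg_sum {ι : Type*} (s : Finset ι) (f : ι → ℝ≥0∞) :
    expNeg (∑ i ∈ s, f i) = ∏ i ∈ s, expNeg (f i) := by
  classical
  induction s using Finset.induction_on with
  | empty => simp
  | insert a s ha ih => rw [Finset.sum_insert ha, Finset.prod_insert ha, expNeg_add, ih]

lemma expNeg_natCast_mul (n : ℕ) (x : ℝ≥0∞) : expNeg (n * x) = expNeg x ^ n := by
  induction n with
  | zero => simp
  | succ n ih => rw [Nat.cast_succ, add_mul, one_mul, expNeg_add, ih, pow_succ]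

@[fun_prop]
lemma measurable_negLog : Measurable negLog :=
  (ENNReal.measurable_log.neg).ereal_toENNReal

lemma expNeg_negLog {v : ℝ≥0∞} (hv : v ≤ 1) : expNeg (negLog v) = v := by
  have h : 0 ≤ -(ENNReal.log v) := by
    rw [EReal.neg_nonneg]; exact ENNReal.log_le_zero_iff.2 hv
  rw [expNeg, negLog, EReal.coe_toENNReal h, neg_neg, ENNReal.exp_log]

lemma negLog_one : negLog 1 = 0 := by simp [negLog]

lemma negLog_eq_top {v : ℝ≥0∞} (hv : v ≤ 1) : negLog v = ∞ ↔ v = 0 := by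
  rw [← expNeg_eq_zero, expNeg_negLog hv]

/-! ### Uniqueness of Laplace transforms -/

lemma integrable_expNeg_pow (μ : Measure ℝ≥0∞) [IsFiniteMeasure μ] (n : ℕ) :
    Integrable (fun t => (expNeg t).toReal ^ n) μ := by
  refine Integrable.of_bound (C := 1)
    (measurable_expNeg.ennreal_toReal.pow_const n).aestronglyMeasurable (ae_of_all _ fun t => ?_)
  rw [Real.norm_eq_abs, abs_of_nonneg (by positivity)]
  exact pow_le_one₀ ENNReal.toReal_nonneg
    (by simpa using ENNReal.toReal_mono ENNReal.one_ne_top (expNeg_le_one t))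

lemma integral_expNeg_pow (μ : Measure ℝ≥0∞) (n : ℕ) :
    ∫ t, (expNeg t).toReal ^ n ∂μ = (∫⁻ t, expNeg (n * t) ∂μ).toReal := by
  rw [← integral_toReal (by fun_prop) (ae_of_all _ fun t => (expNeg_ne_top _).lt_top)]
  simp [expNeg_natCast_mul]

/-- A finite measure on `[0, ∞]` is determined by the values of its Laplace transform at the
natural numbers. -/
theorem measure_ext_of_laplace {μ ν : Measure ℝ≥0∞} [IsFiniteMeasure μ] [IsFiniteMeasure ν]
    (h : ∀ n : ℕ, ∫⁻ t, expNeg (n * t) ∂μ = ∫⁻ t, expNeg (n * t) ∂ν) : μ = ν := by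
  -- Polynomials in `exp (-t)` separate the points of the compact space `[0, ∞]`; the hypothesis
  -- gives equality of the integrals of the monomials `exp (-n t)`.
  let A : StarSubalgebra ℝ (BoundedContinuousFunction ℝ≥0∞ ℝ) :=
    { carrier := {f | ∃ p : Polynomial ℝ, ∀ t, f t = p.eval (expNeg t).toReal}
      mul_mem' := by
        rintro f g ⟨p, hp⟩ ⟨q, hq⟩
        exact ⟨p * q, fun t => by simp [hp, hq]⟩
      add_mem' := by
        rintro f g ⟨p, hp⟩ ⟨q, hq⟩
        exact ⟨p + q, fun t => by simp [hp, hq]⟩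
      algebraMap_mem' := fun r => ⟨Polynomial.C r, fun t => by simp⟩
      star_mem' := by
        rintro f ⟨p, hp⟩
        exact ⟨p, fun t => by simp [hp]⟩ }
  refine ext_of_forall_mem_subalgebra_integral_eq_of_polish (𝕜 := ℝ) (A := A) ?_ ?_
  · intro x y hxy
    let z : BoundedContinuousFunction ℝ≥0∞ ℝ :=
      BoundedContinuousFunction.mkOfCompact
        ⟨fun t => (expNeg t).toReal, ENNReal.continuousOn_toReal.comp_continuous
          continuous_expNeg expNeg_ne_top⟩
    refine ⟨fun t => (expNeg t).toReal, ⟨z, ⟨z, ⟨Polynomial.X, fun t => ?_⟩, rfl⟩, rfl⟩, ?_⟩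
    · simp [z]
    · intro hz
      exact hxy (expNeg_strictAnti.injective
        ((ENNReal.toReal_eq_toReal_iff' (expNeg_ne_top _) (expNeg_ne_top _)).1 hz))
  · rintro g ⟨p, hp⟩
    simp_rw [hp, Polynomial.eval_eq_sum_range]
    rw [integral_finsetSum _ fun i _ => (integrable_expNeg_pow μ i).const_mul _,
      integral_finsetSum _ fun i _ => (integrable_expNeg_pow ν i).const_mul _]
    refine Finset.sum_congr rfl fun i _ => ?_
    rw [integral_const_mul, integral_const_mul, integral_expNeg_pow, integral_expNeg_pow, h]

/-! ### Transforms of the Poisson law -/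

open scoped NNReal Nat in
lemma lintegral_poissonMeasure (r : ℝ≥0) (f : ℕ → ℝ≥0∞) :
    ∫⁻ k, f k ∂poissonMeasure r
      = ∑' k : ℕ, ENNReal.ofReal (Real.exp (-r) * r ^ k / k !) * f k := by
  simp [poissonMeasure, lintegral_sum_measure]

open scoped NNReal in
lemma lintegral_pow_poissonMeasure (r : ℝ≥0) {v : ℝ≥0∞} (hv : v ≤ 1) :
    ∫⁻ k : ℕ, v ^ k ∂poissonMeasure r = expNeg (r * (1 - v)) := by
  have hv' : v ≠ ∞ := ne_top_of_le_ne_top (by simp) hv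
  obtain ⟨w, rfl⟩ : ∃ w : ℝ≥0, v = w := ⟨v.toNNReal, by simp [hv']⟩
  have hw : (w : ℝ) ≤ 1 := by exact_mod_cast hv
  rw [lintegral_poissonMeasure]
  have h : HasSum (fun k : ℕ => Real.exp (-r) * r ^ k / k.factorial * (w : ℝ) ^ k)
      (Real.exp (-(r * (1 - w)))) := by
    have h1 := (NormedSpace.expSeries_div_hasSum_exp ((r : ℝ) * w)).mul_left (Real.exp (-r))
    rw [← Real.exp_eq_exp_ℝ, ← Real.exp_add] at h1
    have e1 : -(r * (1 - w) : ℝ) = -r + r * w := by ring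
    have e2 : (fun k : ℕ => Real.exp (-r) * r ^ k / k.factorial * (w : ℝ) ^ k)
        = fun k : ℕ => Real.exp (-r) * (((r : ℝ) * w) ^ k / k.factorial) := by
      ext k; rw [mul_pow]; ring
    rwa [e1, e2]
  have h2 : (r : ℝ≥0∞) * (1 - w) = ENNReal.ofReal (r * (1 - w)) := by
    rw [ENNReal.ofReal_mul (by positivity), ENNReal.ofReal_sub _ (by positivity)]
    simp
  rw [h2, expNeg_ofReal (mul_nonneg (by positivity) (by linarith)), ← h.tsum_eq,
    ENNReal.ofReal_tsum_of_nonneg (fun k => by positivity) h.summable]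
  refine tsum_congr fun k => ?_
  rw [ENNReal.ofReal_mul (by positivity), ENNReal.ofReal_pow (by positivity),
    ENNReal.ofReal_coe_nnreal]

open scoped NNReal in
lemma lintegral_natCast_poissonMeasure (r : ℝ≥0) :
    ∫⁻ k : ℕ, (k : ℝ≥0∞) ∂poissonMeasure r = r := by
  have h1 := lintegral_pow_poissonMeasure r le_rfl
  rw [lintegral_poissonMeasure] at h1 ⊢
  rw [tsum_eq_zero_add' ENNReal.summable]
  simp only [one_pow, mul_one, tsub_self, mul_zero, expNeg_zero] at h1
  calc _ = ∑' k : ℕ, r * ENNReal.ofReal (Real.exp (-r) * r ^ k / k.factorial) := by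
        rw [Nat.cast_zero, mul_zero, zero_add]
        refine tsum_congr fun k => ?_
        rw [← ENNReal.ofReal_coe_nnreal, ← ENNReal.ofReal_natCast,
          ← ENNReal.ofReal_mul (by positivity), ← ENNReal.ofReal_mul (by positivity)]
        congr 1
        rw [Nat.factorial_succ]
        push_cast
        field_simp
        ring
    _ = r := by rw [ENNReal.tsum_mul_left, h1, mul_one]

/-! ### Counts of a point process -/

lemma toENNReal_count {E : Type*} (x : ℕ → E) (B : Set E) :
    ((count x B : ℕ∞) : ℝ≥0∞) = ∑' n, B.indicator 1 (x n) := by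
  rw [count, ← ENNReal.tsum_set_one, tsum_subtype _ (fun _ => (1 : ℝ≥0∞))]
  rfl

/-- The sum is the integral of `f` against the counting measure `∑ δ_{x n}`. This reduces it to
finitely many counts of disjoint sets, about which the definition of a Poisson process speaks. -/
lemma tsum_simpleFunc {E : Type*} [MeasurableSpace E] (x : ℕ → E) (f : SimpleFunc E ℝ≥0∞) :
    ∑' n, f (x n) = ∑ c ∈ f.range, c * ((count x (f ⁻¹' {c}) : ℕ∞) : ℝ≥0∞) := by
  have h1 : ∑' n, f (x n) = ∫⁻ y, f y ∂(Measure.sum fun n => Measure.dirac (x n)) := by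
    rw [lintegral_sum_measure]
    exact tsum_congr fun n => (lintegral_dirac' _ f.measurable).symm
  rw [h1, SimpleFunc.lintegral_eq_lintegral, SimpleFunc.lintegral]
  refine Finset.sum_congr rfl fun c _ => ?_
  rw [Measure.sum_apply _ (f.measurableSet_fiber c), toENNReal_count]
  congr 1
  exact tsum_congr fun n => Measure.dirac_apply' _ (f.measurableSet_fiber c)

/-! ### Laplace functional of a Poisson process. -/

namespace IsPoissonProcess

variable {Ω E : Type*} [MeasurableSpace Ω] [MeasurableSpace E] {X : ℕ → Ω → E} {Λ : Measure E}
  {P : Measure Ω}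

lemma measurable_count (hX : IsPoissonProcess X Λ P) {B : Set E} (hB : MeasurableSet B) :
    Measurable fun ω => count (fun n => X n ω) B := by
  refine measurable_encard.comp (measurable_set_iff.2 fun n => ?_)
  exact measurableSet_setOfPred.1 (hX.measurable n hB)

lemma lintegral_comp_count (hX : IsPoissonProcess X Λ P) {B : Set E} (hB : MeasurableSet B)
    (hB' : Λ B ≠ ∞) (φ : ℕ∞ → ℝ≥0∞) :
    ∫⁻ ω, φ (count (fun n => X n ω) B) ∂P = ∫⁻ k : ℕ, φ k ∂poissonMeasure (Λ B).toNNReal := by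
  rw [(hX.count_law B hB hB').lintegral_comp (Measurable.of_discrete).aemeasurable,
    lintegral_map .of_discrete .of_discrete]

lemma lintegral_count (hX : IsPoissonProcess X Λ P) {B : Set E} (hB : MeasurableSet B)
    (hB' : Λ B ≠ ∞) :
    ∫⁻ ω, (count (fun n => X n ω) B : ℝ≥0∞) ∂P = Λ B := by
  rw [hX.lintegral_comp_count hB hB' (fun k => (k : ℝ≥0∞))]
  simp only [ENat.toENNReal_coe]
  rw [lintegral_natCast_poissonMeasure, ENNReal.coe_toNNReal hB']

lemma lintegral_expNeg_count (hX : IsPoissonProcess X Λ P) {B : Set E} (hB : MeasurableSet B)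
    (hB' : Λ B ≠ ∞) (c : ℝ≥0∞) :
    ∫⁻ ω, expNeg (c * (count (fun n => X n ω) B : ℝ≥0∞)) ∂P = expNeg ((1 - expNeg c) * Λ B) := by
  rw [hX.lintegral_comp_count hB hB' (fun k => expNeg (c * k))]
  simp only [ENat.toENNReal_coe, mul_comm c, expNeg_natCast_mul]
  rw [lintegral_pow_poissonMeasure _ (expNeg_le_one c), ENNReal.coe_toNNReal hB', mul_comm]

/-- The counts of the level sets are independent Poisson variables, so the expectation factors into
Poisson generating functions. -/
lemma laplace_simpleFunc (hX : IsPoissonProcess X Λ P) (f : SimpleFunc E ℝ≥0∞)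
    (hf : ∀ c, c ≠ 0 → Λ (f ⁻¹' {c}) ≠ ∞) :
    ∫⁻ ω, expNeg (∑' n, f (X n ω)) ∂P = expNeg (∫⁻ y, (1 - expNeg (f y)) ∂Λ) := by
  classical
  -- The level set of the value `0` may have infinite mass, where nothing is assumed about counts;
  -- it contributes the factor `1` and is dropped.
  set F : Finset ℝ≥0∞ := f.range.filter (· ≠ 0) with hF
  have hF0 (c : F) : (c : ℝ≥0∞) ≠ 0 := (Finset.mem_filter.1 c.2).2
  have h1 (ω : Ω) : expNeg (∑' n, f (X n ω))
      = ∏ i : Fin F.card, expNeg ((F.equivFin.symm i : ℝ≥0∞)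
          * (count (fun n => X n ω) (f ⁻¹' {(F.equivFin.symm i : ℝ≥0∞)}) : ℝ≥0∞)) := by
    rw [tsum_simpleFunc, expNeg_sum, ← Finset.prod_filter_of_ne (p := (· ≠ 0)), ← hF,
      ← Finset.prod_coe_sort, Equiv.prod_comp F.equivFin.symm (fun c : F => expNeg ((c : ℝ≥0∞)
          * (count (fun n => X n ω) (f ⁻¹' {(c : ℝ≥0∞)}) : ℝ≥0∞)))]
    rintro c - h rfl
    simp at h
  have h2 : ∫⁻ y, (1 - expNeg (f y)) ∂Λ = ∑ c ∈ F, (1 - expNeg c) * Λ (f ⁻¹' {c}) := by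
    have := SimpleFunc.lintegral_eq_lintegral (f.map fun c => 1 - expNeg c) Λ
    rw [SimpleFunc.map_lintegral] at this
    simp only [SimpleFunc.coe_map, Function.comp_apply] at this
    rw [this, hF, Finset.sum_filter_of_ne]
    rintro c - h rfl
    simp at h
  have hind := hX.count_indep F.card (fun i => f ⁻¹' {(F.equivFin.symm i : ℝ≥0∞)})
    (fun i => f.measurableSet_fiber _) (fun i => hf _ (hF0 _))
    (fun i j hij => by
      refine Disjoint.preimage _ (Set.disjoint_singleton.2 fun h => hij ?_)
      exact F.equivFin.symm.injective (Subtype.ext h))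
  simp_rw [h1]
  rw [lintegral_prod_eq_prod_lintegral_of_indepFun Finset.univ
    (fun i ω => expNeg ((F.equivFin.symm i : ℝ≥0∞)
      * (count (fun n => X n ω) (f ⁻¹' {(F.equivFin.symm i : ℝ≥0∞)}) : ℝ≥0∞)))]
  · simp_rw [hX.lintegral_expNeg_count (f.measurableSet_fiber _) (hf _ (hF0 _))]
    rw [h2, expNeg_sum, ← Finset.prod_coe_sort F,
      Equiv.prod_comp F.equivFin.symm (fun c : F => expNeg ((1 - expNeg (c : ℝ≥0∞))
          * Λ (f ⁻¹' {(c : ℝ≥0∞)})))]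
  · exact hind.comp (fun i (k : ℕ∞) => expNeg ((F.equivFin.symm i : ℝ≥0∞) * (k : ℝ≥0∞)))
      (fun i => .of_discrete)
  · intro i
    exact (Measurable.of_discrete (f := fun k : ℕ∞ =>
      expNeg ((F.equivFin.symm i : ℝ≥0∞) * (k : ℝ≥0∞)))).comp
        (hX.measurable_count (f.measurableSet_fiber _))

/-- The Laplace functional of a Poisson process. -/
theorem laplace [SigmaFinite Λ] [IsProbabilityMeasure P] (hX : IsPoissonProcess X Λ P)
    {u : E → ℝ≥0∞} (hu : Measurable u) :
    ∫⁻ ω, expNeg (∑' n, u (X n ω)) ∂P = expNeg (∫⁻ y, (1 - expNeg (u y)) ∂Λ) := by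
  -- Restricting to the spanning sets makes every nonzero level set of finite mass. The left side
  -- then converges by domination, the right side by monotonicity.
  let f (n : ℕ) : SimpleFunc E ℝ≥0∞ := (SimpleFunc.eapprox u n).restrict (spanningSets Λ n)
  have hfa (n : ℕ) (y : E) :
      f n y = (spanningSets Λ n).indicator (SimpleFunc.eapprox u n) y :=
    SimpleFunc.restrict_apply _ (measurableSet_spanningSets Λ n) y
  have hmono (y : E) : Monotone fun n => f n y := by
    intro m n hmn
    simp only [hfa]
    refine (Set.indicator_le_indicator_of_subset (monotone_spanningSets Λ hmn)
      (fun _ => zero_le) y).trans ?_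
    exact Set.indicator_le_indicator (SimpleFunc.monotone_eapprox u hmn y)
  have hlim (y : E) : Tendsto (fun n => f n y) atTop (𝓝 (u y)) := by
    refine (SimpleFunc.tendsto_eapprox hu y).congr' ?_
    filter_upwards [eventually_ge_atTop (spanningSetsIndex Λ y)] with n hn
    rw [hfa, Set.indicator_of_mem (mem_spanningSets_of_index_le Λ y hn)]
  have hleft : Tendsto (fun n => ∫⁻ ω, expNeg (∑' k, f n (X k ω)) ∂P) atTop
      (𝓝 (∫⁻ ω, expNeg (∑' k, u (X k ω)) ∂P)) := by
    refine tendsto_lintegral_of_dominated_convergence (fun _ => 1) (fun n => ?_)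
      (fun n => ae_of_all _ fun ω => expNeg_le_one _) (by simp) (ae_of_all _ fun ω => ?_)
    · exact measurable_expNeg.comp
        (Measurable.tsum fun k => (f n).measurable.comp (hX.measurable k))
    · refine (continuous_expNeg.tendsto _).comp ?_
      simp_rw [← MeasureTheory.lintegral_count]
      exact lintegral_tendsto_of_tendsto_of_monotone (fun n => .of_discrete)
        (ae_of_all _ fun k => hmono (X k ω)) (ae_of_all _ fun k => hlim _)
  have hright : Tendsto (fun n => expNeg (∫⁻ y, (1 - expNeg (f n y)) ∂Λ)) atTop
      (𝓝 (expNeg (∫⁻ y, (1 - expNeg (u y)) ∂Λ))) := by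
    refine (continuous_expNeg.tendsto _).comp ?_
    refine lintegral_tendsto_of_tendsto_of_monotone (fun n => ?_)
        (ae_of_all _ fun y => fun m n hmn => ?_) (ae_of_all _ fun y => ?_)
    · exact (measurable_const.sub (measurable_expNeg.comp (f n).measurable)).aemeasurable
    · exact tsub_le_tsub_left (expNeg_antitone (hmono y hmn)) _
    · exact ENNReal.Tendsto.sub tendsto_const_nhds
        ((continuous_expNeg.tendsto _).comp (hlim y)) (Or.inl (by simp))
  refine tendsto_nhds_unique hleft (hright.congr fun n => ?_)
  refine (hX.laplace_simpleFunc (f n) fun c hc => ?_).symm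
  refine ((measure_mono ?_).trans_lt (measure_spanningSets_lt_top Λ n)).ne
  intro y hy
  by_contra hy'
  simp only [Set.mem_preimage, Set.mem_singleton_iff, hfa, Set.indicator_of_notMem hy'] at hy
  exact hc hy.symm

end IsPoissonProcess
-- Mecke's formula for exponential functionals.
lemma one_sub_mul_eq {v z : ℝ≥0∞} (hv : v ≤ 1) (hz : z ≤ 1) :
    1 - v * z = (1 - v) + (1 - z) * v := by
  refine ENNReal.sub_eq_of_eq_add (ne_top_of_le_ne_top (by simp) (mul_le_one' hv hz)) ?_
  rw [add_assoc, mul_comm v z, ← add_mul, tsub_add_cancel_of_le hz, one_mul,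
    tsub_add_cancel_of_le hv]

/-- Two measures that agree on the sets of finite mass of a third, σ-finite, one are equal. -/
lemma measure_ext_of_finite {E : Type*} [MeasurableSpace E] {μ ν Λ : Measure E} [SigmaFinite Λ]
    (h : ∀ A, MeasurableSet A → Λ A ≠ ∞ → μ A = ν A) : μ = ν := by
  ext A hA
  have hU : A = ⋃ n, A ∩ spanningSets Λ n := by
    rw [← Set.inter_iUnion, iUnion_spanningSets, Set.inter_univ]
  have hm : Monotone fun n => A ∩ spanningSets Λ n := fun m n hmn =>
    Set.inter_subset_inter_right _ (monotone_spanningSets Λ hmn)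
  rw [hU, hm.measure_iUnion, hm.measure_iUnion]
  refine iSup_congr fun n => h _ (hA.inter (measurableSet_spanningSets Λ n)) ?_
  exact ((measure_mono Set.inter_subset_right).trans_lt (measure_spanningSets_lt_top Λ n)).ne

/-- The infinite product of one-term transforms is written as `expNeg` of a sum of `negLog`s, the
form to which the Laplace functional of the locations applies. -/
lemma lintegral_expNeg_tsum {Ω : Type*} [MeasurableSpace Ω] {P : Measure Ω}
    {Z : ℕ → Ω → ℝ≥0∞} (hZ : ∀ j, Measurable (Z j)) (hind : iIndepFun Z P) :
    ∫⁻ ω, expNeg (∑' j, Z j ω) ∂P = expNeg (∑' j, negLog (∫⁻ ω, expNeg (Z j ω) ∂P)) := by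
  have : IsProbabilityMeasure P := hind.isProbabilityMeasure
  have h1 : Tendsto (fun n => ∫⁻ ω, expNeg (∑ j ∈ Finset.range n, Z j ω) ∂P) atTop
      (𝓝 (∫⁻ ω, expNeg (∑' j, Z j ω) ∂P)) := by
    refine tendsto_lintegral_of_dominated_convergence (fun _ => 1) (fun n => by fun_prop)
      (fun n => ae_of_all _ fun ω => expNeg_le_one _) (by simp) (ae_of_all _ fun ω => ?_)
    exact (continuous_expNeg.tendsto _).comp (ENNReal.tendsto_nat_tsum _)
  have h2 := (continuous_expNeg.tendsto _).comp
    (ENNReal.tendsto_nat_tsum fun j => negLog (∫⁻ ω, expNeg (Z j ω) ∂P))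
  refine tendsto_nhds_unique h1 (h2.congr fun n => ?_)
  simp only [Function.comp_apply, expNeg_sum]
  rw [lintegral_prod_eq_prod_lintegral_of_indepFun _ (fun j ω => expNeg (Z j ω))
    (hind.comp (fun _ => expNeg) fun _ => measurable_expNeg)
    (fun j => measurable_expNeg.comp (hZ j))]
  refine Finset.prod_congr rfl fun j _ => expNeg_negLog ?_
  exact (lintegral_mono fun ω => expNeg_le_one _).trans (by simp)

namespace IsPoissonProcess

variable {Ω E : Type*} [MeasurableSpace Ω] [MeasurableSpace E] {X : ℕ → Ω → E} {Λ : Measure E}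
  {P : Measure Ω}

lemma ae_notMem (hX : IsPoissonProcess X Λ P) {B : Set E} (hB : MeasurableSet B)
    (hB' : Λ B = 0) : ∀ᵐ ω ∂P, ∀ i, X i ω ∉ B := by
  have h := hX.lintegral_count hB (by simp [hB'])
  have hm : Measurable fun ω => (count (fun n => X n ω) B : ℝ≥0∞) :=
    (Measurable.of_discrete (f := fun k : ℕ∞ => (k : ℝ≥0∞))).comp (hX.measurable_count hB)
  rw [hB', lintegral_eq_zero_iff hm] at h
  filter_upwards [h] with ω hω i hi
  simp only [Pi.zero_apply, ENat.toENNReal_eq_zero, count, Set.encard_eq_zero] at hω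
  exact Set.notMem_empty i (hω ▸ hi)

/-- Adding `c 1_A` to `u` in the Laplace functional gives, as a function of `c`, the Laplace
transform of the count of `A` under the weight `exp (-∑ u)`. It is that of `L` times a Poisson law
with mean `∫_A exp (-u)`, so uniqueness identifies the weighted law and its mean is read off,
without differentiating in `c`. -/
lemma lintegral_count_mul_expNeg [SigmaFinite Λ] [IsProbabilityMeasure P]
    (hX : IsPoissonProcess X Λ P) {u : E → ℝ≥0∞} (hu : Measurable u) {A : Set E}
    (hA : MeasurableSet A) (hA' : Λ A ≠ ∞) :
    ∫⁻ ω, expNeg (∑' j, u (X j ω)) * (count (fun n => X n ω) A : ℝ≥0∞) ∂P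
      = expNeg (∫⁻ y, (1 - expNeg (u y)) ∂Λ) * ∫⁻ y in A, expNeg (u y) ∂Λ := by
  set L := expNeg (∫⁻ y, (1 - expNeg (u y)) ∂Λ) with hL
  set a := ∫⁻ y in A, expNeg (u y) ∂Λ with ha
  have ha' : a ≠ ∞ := by
    refine ne_top_of_le_ne_top hA' ((lintegral_mono fun y => expNeg_le_one _).trans ?_)
    simp
  set D : Ω → ℝ≥0∞ := fun ω => expNeg (∑' j, u (X j ω)) with hD
  set NA : Ω → ℝ≥0∞ := fun ω => (count (fun n => X n ω) A : ℝ≥0∞) with hNA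
  have hDm : Measurable D :=
    measurable_expNeg.comp (Measurable.tsum fun j => hu.comp (hX.measurable j))
  have hNm : Measurable NA := (Measurable.of_discrete (f := fun k : ℕ∞ => (k : ℝ≥0∞))).comp
    (hX.measurable_count hA)
  have key (c : ℝ≥0∞) : ∫⁻ ω, D ω * expNeg (c * NA ω) ∂P = L * expNeg (a * (1 - expNeg c)) := by
    have h1 := hX.laplace (u := fun y => u y + A.indicator (fun _ => c) y)
      (hu.add (measurable_const.indicator hA))
    have h2 : ∫⁻ y, (1 - expNeg (u y + A.indicator (fun _ => c) y)) ∂Λ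
        = ∫⁻ y, (1 - expNeg (u y)) ∂Λ + a * (1 - expNeg c) := by
      rw [ha, ← lintegral_mul_const _ (by fun_prop), ← lintegral_indicator hA,
        ← lintegral_add_left (by fun_prop)]
      refine lintegral_congr fun y => ?_
      by_cases hy : y ∈ A
      · simp only [Set.indicator_of_mem hy, expNeg_add]
        rw [one_sub_mul_eq (expNeg_le_one _) (expNeg_le_one _), mul_comm (1 - expNeg c)]
      · simp [Set.indicator_of_notMem hy]
    rw [h2, expNeg_add, ← hL] at h1
    rw [← h1]
    refine lintegral_congr fun ω => ?_
    rw [ENNReal.tsum_add, expNeg_add, hD, hNA]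
    simp only
    rw [toENNReal_count, ← ENNReal.tsum_mul_left]
    congr 2
    refine tsum_congr fun n => ?_
    by_cases h : X n ω ∈ A <;> simp [h]
  have hlaw : (P.withDensity D).map NA
      = L • (poissonMeasure a.toNNReal).map (fun k : ℕ => (k : ℝ≥0∞)) := by
    have hf1 : IsFiniteMeasure (P.withDensity D) := by
      refine isFiniteMeasure_withDensity (ne_top_of_le_ne_top (by simp : (1 : ℝ≥0∞) ≠ ∞) ?_)
      exact (lintegral_mono fun ω => expNeg_le_one _).trans (by simp)
    have hf3 : IsFiniteMeasure (L • (poissonMeasure a.toNNReal).map (fun k : ℕ => (k : ℝ≥0∞))) :=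
      Measure.smul_finite _ (expNeg_ne_top _)
    refine measure_ext_of_laplace fun n => ?_
    rw [lintegral_map (by fun_prop) hNm, lintegral_withDensity_eq_lintegral_mul _ hDm (by fun_prop),
      lintegral_smul_measure, lintegral_map (by fun_prop) .of_discrete]
    simp only [Pi.mul_apply]
    rw [key]
    congr 1
    simp_rw [mul_comm (n : ℝ≥0∞), expNeg_natCast_mul]
    rw [lintegral_pow_poissonMeasure _ (expNeg_le_one _), ENNReal.coe_toNNReal ha']
  have h3 : ∫⁻ t, t ∂((P.withDensity D).map NA) = L * a := by
    rw [hlaw, lintegral_smul_measure, lintegral_map measurable_id' .of_discrete,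
      lintegral_natCast_poissonMeasure, ENNReal.coe_toNNReal ha', smul_eq_mul]
  rw [lintegral_map measurable_id' hNm, lintegral_withDensity_eq_lintegral_mul _ hDm hNm] at h3
  exact h3

/-- Mecke's formula for a Poisson process and the functionals
`(x, η) ↦ 1_A(x) exp (-∫ u dη)`. -/
theorem mecke_expNeg [SigmaFinite Λ] [IsProbabilityMeasure P]
    (hX : IsPoissonProcess X Λ P) {u : E → ℝ≥0∞} (hu : Measurable u) (hu' : ∀ᵐ y ∂Λ, u y ≠ ∞)
    {A : Set E} (hA : MeasurableSet A) :
    ∑' i, ∫⁻ ω, A.indicator 1 (X i ω) * expNeg (∑' j, if j = i then 0 else u (X j ω)) ∂P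
      = Λ A * expNeg (∫⁻ y, (1 - expNeg (u y)) ∂Λ) := by
  set L := expNeg (∫⁻ y, (1 - expNeg (u y)) ∂Λ) with hL
  set D : Ω → ℝ≥0∞ := fun ω => expNeg (∑' j, u (X j ω)) with hD
  have hDm : Measurable D :=
    measurable_expNeg.comp (Measurable.tsum fun j => hu.comp (hX.measurable j))
  have hEm : Measurable fun y => expNeg (u y) := measurable_expNeg.comp hu
  -- The intensity of the process under the weight `D`; here `D` still contains the contribution of
  -- the point `i` itself.
  have hmeas : (Measure.sum fun i => (P.withDensity D).map (X i))
      = L • Λ.withDensity fun y => expNeg (u y) := by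
    refine measure_ext_of_finite (Λ := Λ) fun B hB hB' => ?_
    rw [Measure.sum_apply _ hB, Measure.smul_apply, withDensity_apply _ hB, smul_eq_mul,
      ← hX.lintegral_count_mul_expNeg hu hB hB']
    simp_rw [toENNReal_count, ← ENNReal.tsum_mul_left]
    have hDB (i : ℕ) : Measurable fun ω =>
        expNeg (∑' j, u (X j ω)) * B.indicator (1 : E → ℝ≥0∞) (X i ω) :=
      hDm.mul ((measurable_one.indicator hB).comp (hX.measurable i))
    rw [lintegral_tsum fun i => (hDB i).aemeasurable]
    refine tsum_congr fun i => ?_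
    rw [Measure.map_apply (hX.measurable i) hB, withDensity_apply _ (hX.measurable i hB),
      ← lintegral_indicator (hX.measurable i hB)]
    refine lintegral_congr fun ω => ?_
    by_cases h : X i ω ∈ B <;> simp [h, hD]
  -- Integrating `1_A exp u` instead of `1_A` removes the factor `exp (-u (X i))` from `D`; this is
  -- legitimate where `u` is finite, hence almost surely at all points.
  have hφ : Measurable (A.indicator fun y => (expNeg (u y))⁻¹) := hEm.inv.indicator hA
  have h1 := congrArg (fun m => ∫⁻ y, A.indicator (fun y => (expNeg (u y))⁻¹) y ∂m) hmeas
  simp only [lintegral_sum_measure, lintegral_smul_measure, smul_eq_mul] at h1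
  rw [lintegral_withDensity_eq_lintegral_mul _ hEm hφ] at h1
  have h2 : ∫⁻ y, ((fun y => expNeg (u y)) * A.indicator fun y => (expNeg (u y))⁻¹) y ∂Λ = Λ A := by
    rw [← lintegral_indicator_one hA]
    refine lintegral_congr_ae ?_
    filter_upwards [hu'] with y hy
    by_cases h : y ∈ A
    · simp [h, ENNReal.mul_inv_cancel (mt expNeg_eq_zero.1 hy) (expNeg_ne_top _)]
    · simp [h]
  rw [h2, mul_comm] at h1
  rw [← h1]
  refine tsum_congr fun i => ?_
  have hφi : Measurable fun ω => A.indicator (fun y => (expNeg (u y))⁻¹) (X i ω) :=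
    hφ.comp (hX.measurable i)
  rw [lintegral_map hφ (hX.measurable i), lintegral_withDensity_eq_lintegral_mul _ hDm hφi]
  refine lintegral_congr_ae ?_
  have hT : MeasurableSet {y | u y = ∞} := hu (measurableSet_singleton ∞)
  filter_upwards [hX.ae_notMem hT (by simpa [ae_iff] using hu')] with ω hω
  have hi : u (X i ω) ≠ ∞ := hω i
  simp only [Pi.mul_apply, hD]
  rw [ENNReal.tsum_eq_add_tsum_ite (f := fun j => u (X j ω)) i, expNeg_add]
  by_cases h : X i ω ∈ A
  · simp only [h, Set.indicator_of_mem, Pi.one_apply, one_mul]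
    rw [mul_right_comm, ENNReal.mul_inv_cancel (mt expNeg_eq_zero.1 hi) (expNeg_ne_top _),
      one_mul]
    exact congrArg expNeg (tsum_congr fun j => by split_ifs <;> rfl)
  · simp [h]

end IsPoissonProcess
/-! ### Gamma laws -/

lemma lintegral_gammaMeasure {a r : ℝ} {f : ℝ → ℝ≥0∞} (hf : Measurable f) :
    ∫⁻ x, f x ∂gammaMeasure a r
      = ∫⁻ x in Set.Ioi 0, ENNReal.ofReal (r ^ a / Real.Gamma a * x ^ (a - 1)
          * Real.exp (-(r * x))) * f x := by
  have hpdf : Measurable (gammaPDF a r) := (measurable_gammaPDFReal a r).ennreal_ofReal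
  rw [gammaMeasure, lintegral_withDensity_eq_lintegral_mul _ hpdf hf,
    ← lintegral_add_compl _ (measurableSet_Ici (a := (0 : ℝ))), Set.compl_Ici,
    setLIntegral_congr_fun (g := fun _ => 0) measurableSet_Iio, lintegral_zero, add_zero,
    restrict_Ioi_eq_restrict_Ici]
  · refine setLIntegral_congr_fun measurableSet_Ici fun x hx => ?_
    simp only [Pi.mul_apply]
    rw [gammaPDF_of_nonneg hx]
  · intro x hx
    simp only [Pi.mul_apply]
    rw [gammaPDF_of_neg hx, zero_mul]

lemma ae_pos_gammaMeasure (a r : ℝ) : ∀ᵐ x ∂gammaMeasure a r, 0 < x := by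
  have h : gammaMeasure a r (Set.Iic 0) = 0 := by
    rw [← lintegral_indicator_one measurableSet_Iic,
      lintegral_gammaMeasure (measurable_one.indicator measurableSet_Iic),
      setLIntegral_congr_fun (g := fun _ => 0) measurableSet_Ioi, lintegral_zero]
    intro x hx
    have : ¬ x ≤ 0 := not_le.2 hx
    simp [this]
  simpa [ae_iff, Set.Iic] using h

lemma lintegral_ofReal_rpow_mul_exp {b r : ℝ} (hb : 0 < b) (hr : 0 < r) {C : ℝ} (hC : 0 ≤ C) :
    ∫⁻ t in Set.Ioi 0, ENNReal.ofReal (C * (t ^ (b - 1) * Real.exp (-(r * t))))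
      = ENNReal.ofReal (C * ((1 / r) ^ b * Real.Gamma b)) := by
  have h := Real.integral_rpow_mul_exp_neg_mul_Ioi hb hr
  have hpos : 0 < (1 / r) ^ b * Real.Gamma b := by
    have := Real.Gamma_pos_of_pos hb
    positivity
  have hint : IntegrableOn (fun t : ℝ => t ^ (b - 1) * Real.exp (-(r * t))) (Set.Ioi 0) :=
    Integrable.of_integral_ne_zero (by rw [h]; exact hpos.ne')
  rw [← h, ← integral_const_mul, ofReal_integral_eq_lintegral_ofReal (hint.const_mul C)]
  filter_upwards [ae_restrict_mem measurableSet_Ioi] with t ht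
  have : (0 : ℝ) < t := ht
  simp only [Pi.zero_apply]
  positivity

lemma lintegral_rpow_gammaMeasure {a r p : ℝ} (ha : 0 < a) (hr : 0 < r) (hp : 0 ≤ p) :
    ∫⁻ x, ENNReal.ofReal (x ^ p) ∂gammaMeasure a r
      = ENNReal.ofReal (r ^ (-p) * (Real.Gamma (a + p) / Real.Gamma a)) := by
  have hG := Real.Gamma_pos_of_pos ha
  rw [lintegral_gammaMeasure (by fun_prop)]
  have h := lintegral_ofReal_rpow_mul_exp (b := a + p) (r := r) (by linarith) hr
    (C := r ^ a / Real.Gamma a) (by positivity)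
  rw [setLIntegral_congr_fun (g := fun t => ENNReal.ofReal (r ^ a / Real.Gamma a *
    (t ^ (a + p - 1) * Real.exp (-(r * t))))) measurableSet_Ioi, h]
  · congr 1
    rw [one_div, Real.inv_rpow hr.le, ← Real.rpow_neg hr.le, neg_add, Real.rpow_add hr,
      Real.rpow_neg hr.le a]
    have := (Real.rpow_pos_of_pos hr a).ne'
    field_simp
  · intro x hx
    have hx : (0 : ℝ) < x := hx
    simp only
    rw [← ENNReal.ofReal_mul (by positivity)]
    congr 1
    rw [show a + p - 1 = (a - 1) + p by ring, Real.rpow_add hx]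
    ring

/-- The Erlang tail `exp (-x) ∑_{k ≤ n} x ^ k / k!`. -/
def erlangTail (n : ℕ) (x : ℝ) : ℝ :=
  Real.exp (-x) * ∑ k ∈ Finset.range n, x ^ k / (k.factorial : ℝ)

/-- `erlangTail (n + 1)` has the terms `k ≤ n`. Differentiating the sum removes its top term, so the
product rule leaves only that term: minus the Gamma density of shape `n + 1`. -/
lemma hasDerivAt_erlangTail (n : ℕ) (x : ℝ) :
    HasDerivAt (erlangTail (n + 1)) (-(Real.exp (-x) * (x ^ n / (n.factorial : ℝ)))) x := by
  have he : HasDerivAt (fun x : ℝ => Real.exp (-x)) (-Real.exp (-x)) x := by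
    simpa using (hasDerivAt_neg x).exp
  have hs : HasDerivAt (fun x : ℝ => ∑ k ∈ Finset.range (n + 1), x ^ k / (k.factorial : ℝ))
      (∑ k ∈ Finset.range n, x ^ k / (k.factorial : ℝ)) x := by
    have h := HasDerivAt.fun_sum (u := Finset.range (n + 1)) (x := x)
      (A := fun k x => x ^ k / (k.factorial : ℝ))
      (A' := fun k => (k * x ^ (k - 1)) / (k.factorial : ℝ))
      (fun k _ => (hasDerivAt_pow k x).div_const _)
    refine h.congr_deriv ?_
    rw [Finset.sum_range_succ']
    simp only [Nat.cast_zero, zero_mul, zero_div, add_zero, Nat.add_sub_cancel]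
    refine Finset.sum_congr rfl fun k _ => ?_
    rw [Nat.factorial_succ]
    push_cast
    field_simp
  have h := he.mul hs
  refine h.congr_deriv ?_
  rw [Finset.sum_range_succ]
  ring

lemma erlangTail_nonneg (n : ℕ) {x : ℝ} (hx : 0 ≤ x) : 0 ≤ erlangTail n x := by
  unfold erlangTail
  positivity

lemma tendsto_erlangTail (n : ℕ) : Tendsto (erlangTail n) atTop (𝓝 0) := by
  have h : Tendsto (fun x : ℝ => ∑ k ∈ Finset.range n, x ^ k * Real.exp (-x) / (k.factorial : ℝ))
      atTop (𝓝 (∑ k ∈ Finset.range n, 0 / (k.factorial : ℝ))) :=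
    tendsto_finsetSum _ fun k _ => (Real.tendsto_pow_mul_exp_neg_atTop_nhds_zero k).div_const _
  simp only [zero_div, Finset.sum_const_zero] at h
  refine h.congr fun x => ?_
  rw [erlangTail, Finset.mul_sum]
  exact Finset.sum_congr rfl fun k _ => by ring

/-- The tail of a Gamma law with integral shape. -/
lemma gammaMeasure_Ioi {m : ℕ} (hm : 0 < m) {r x : ℝ} (hr : 0 < r) (hx : 0 ≤ x) :
    gammaMeasure m r (Set.Ioi x) = ENNReal.ofReal (erlangTail m (r * x)) := by
  obtain ⟨n, rfl⟩ : ∃ n, m = n + 1 := ⟨m - 1, by omega⟩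
  have hd (t : ℝ) : HasDerivAt (fun t => -erlangTail (n + 1) (r * t))
      (r * (Real.exp (-(r * t)) * ((r * t) ^ n / (n.factorial : ℝ)))) t := by
    have h1 : HasDerivAt (fun t : ℝ => r * t) r t := by
      simpa using (hasDerivAt_id t).const_mul r
    refine ((hasDerivAt_erlangTail n (r * t)).comp t h1).neg.congr_deriv ?_
    ring
  have hlim : Tendsto (fun t => -erlangTail (n + 1) (r * t)) atTop (𝓝 (-0)) :=
    ((tendsto_erlangTail (n + 1)).comp (tendsto_id.const_mul_atTop hr)).neg
  have hpos : ∀ t ∈ Set.Ioi x, 0 ≤ r * (Real.exp (-(r * t)) * ((r * t) ^ n / (n.factorial : ℝ))) := by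
    intro t ht
    have : (0 : ℝ) ≤ t := hx.trans (le_of_lt ht)
    positivity
  have hI := integral_Ioi_of_hasDerivAt_of_nonneg' (fun t _ => hd t) hpos hlim
  have hInt := integrableOn_Ioi_deriv_of_nonneg' (fun t _ => hd t) hpos hlim
  rw [← lintegral_indicator_one measurableSet_Ioi,
    lintegral_gammaMeasure (measurable_one.indicator measurableSet_Ioi)]
  have h1 : ∀ t ∈ Set.Ioi (0 : ℝ), ENNReal.ofReal (r ^ ((n + 1 : ℕ) : ℝ)
      / Real.Gamma ((n + 1 : ℕ) : ℝ) * t ^ (((n + 1 : ℕ) : ℝ) - 1) * Real.exp (-(r * t)))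
        * (Set.Ioi x).indicator 1 t = (Set.Ioi x).indicator (fun t => ENNReal.ofReal
          (r * (Real.exp (-(r * t)) * ((r * t) ^ n / (n.factorial : ℝ))))) t := by
    intro t ht
    by_cases h : t ∈ Set.Ioi x
    · simp only [Set.indicator_of_mem h, Pi.one_apply, mul_one]
      congr 1
      rw [Real.rpow_natCast, Nat.cast_succ, add_sub_cancel_right, Real.rpow_natCast,
        Real.Gamma_nat_eq_factorial]
      ring
    · simp [Set.indicator_of_notMem h]
  rw [setLIntegral_congr_fun measurableSet_Ioi h1, lintegral_indicator measurableSet_Ioi,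
    Measure.restrict_restrict measurableSet_Ioi, Set.inter_eq_left.2 (Set.Ioi_subset_Ioi hx),
    ← ofReal_integral_eq_lintegral_ofReal hInt
      ((ae_restrict_mem measurableSet_Ioi).mono fun t ht => hpos t ht), hI]
  congr 1
  ring

/-! ### The Laplace exponent of the interference field -/

lemma volume_lt_rpow_norm {α t : ℝ} (hα : 0 < α) (ht : 0 < t) :
    volume {y : Plane | t < ‖y‖ ^ (-α)} = ENNReal.ofReal (Real.pi * t ^ (-(2 / α))) := by
  -- The origin is excluded because the real power `0 ^ (-α)` is `0`.
  have hset : {y : Plane | t < ‖y‖ ^ (-α)} = Metric.ball 0 (t ^ (-(1 / α))) \ {0} := by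
    ext y
    simp only [Set.mem_ofPred_eq, Set.mem_sdiff, mem_ball_zero_iff, Set.mem_singleton_iff]
    rcases eq_or_ne y 0 with rfl | hy
    · simp [Real.zero_rpow (neg_ne_zero.2 hα.ne'), ht.le]
    · have hy' : 0 < ‖y‖ := norm_pos_iff.2 hy
      simp only [hy, not_false_eq_true, and_true]
      have h := Real.rpow_lt_rpow_iff_of_neg (x := ‖y‖ ^ (-α)) (y := t) (z := -(1 / α))
        (by positivity) ht (by simpa using hα)
      rw [← Real.rpow_mul hy'.le, show -α * -(1 / α) = 1 by field_simp, Real.rpow_one] at h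
      exact h.symm
  rw [hset, measure_sdiff_null (by simp), EuclideanSpace.volume_ball_fin_two,
    ← ENNReal.ofReal_pow (by positivity), ← ENNReal.ofReal_mul (by positivity), mul_comm,
    ← Real.rpow_natCast, ← Real.rpow_mul ht.le]
  congr 3
  push_cast
  ring

/-- Layer cake: `1 - exp (-c v)` is the integral of `c exp (-c t)` over `[0, v]`, and for `v = ‖y‖ ^
(-α)` the superlevel sets have area `π t ^ (-2/α)`. What remains is a Gamma integral with parameter
`1 - 2/α`, positive exactly because `α > 2`. -/
lemma lintegral_one_sub_expNeg_norm {α c : ℝ} (hα : 2 < α) (hc : 0 ≤ c) :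
    ∫⁻ y : Plane, (1 - expNeg (ENNReal.ofReal c * ‖y‖ₑ ^ (-α)))
      = ENNReal.ofReal (Real.pi * c ^ (2 / α) * Real.Gamma (1 - 2 / α)) := by
  have hα0 : 0 < α := by linarith
  have hα2 : 0 < 2 / α := by positivity
  have hα3 : 0 < 1 - 2 / α := by rw [sub_pos, div_lt_one hα0]; exact hα
  rcases hc.eq_or_lt with rfl | hc
  · simp [Real.zero_rpow hα2.ne']
  have hcake := lintegral_comp_eq_lintegral_meas_lt_mul (volume : Measure Plane)
    (f := fun y => ‖y‖ ^ (-α)) (g := fun t => c * Real.exp (-(c * t)))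
    (ae_of_all _ fun y => by simp only [Pi.zero_apply]; positivity)
    (Measurable.aemeasurable (by fun_prop))
    (fun t _ => Continuous.intervalIntegrable (by fun_prop) _ _)
    (ae_of_all _ fun t => by positivity)
  have hne : ∀ᵐ y : Plane, y ≠ 0 := by simp [ae_iff]
  calc _ = ∫⁻ y : Plane, ENNReal.ofReal (∫ t in (0 : ℝ)..‖y‖ ^ (-α), c * Real.exp (-(c * t))) := by
        refine lintegral_congr_ae ?_
        filter_upwards [hne] with y hy
        have hy' : 0 < ‖y‖ := norm_pos_iff.2 hy
        have hd (t : ℝ) : HasDerivAt (fun t => -Real.exp (-(c * t))) (c * Real.exp (-(c * t))) t := by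
          have h1 : HasDerivAt (fun t : ℝ => -(c * t)) (-c) t := by
            simpa using ((hasDerivAt_id t).const_mul c).fun_neg
          refine h1.exp.neg.congr_deriv ?_
          ring
        rw [intervalIntegral.integral_eq_sub_of_hasDerivAt (fun t _ => hd t)
          (Continuous.intervalIntegrable (by fun_prop) _ _), ← ofReal_norm,
          ENNReal.ofReal_rpow_of_pos hy', ← ENNReal.ofReal_mul hc.le,
          expNeg_ofReal (by positivity), ← ENNReal.ofReal_one,
          ← ENNReal.ofReal_sub _ (Real.exp_pos _).le]
        congr 1
        simp
        ring
    _ = ∫⁻ t in Set.Ioi (0 : ℝ), ENNReal.ofReal ((Real.pi * c) * (t ^ (1 - 2 / α - 1)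
          * Real.exp (-(c * t)))) := by
        rw [hcake]
        refine setLIntegral_congr_fun measurableSet_Ioi fun t ht => ?_
        have ht : (0 : ℝ) < t := ht
        rw [volume_lt_rpow_norm hα0 ht, ← ENNReal.ofReal_mul (by positivity),
          show 1 - 2 / α - 1 = -(2 / α) by ring]
        congr 1
        ring
    _ = _ := by
        rw [lintegral_ofReal_rpow_mul_exp hα3 hc (by positivity)]
        congr 1
        rw [one_div, Real.inv_rpow hc.le, ← Real.rpow_neg hc.le, neg_sub, Real.rpow_sub hc,
          Real.rpow_one]
        field_simp

@[fun_prop]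
lemma measurable_power (α : ℝ) : Measurable fun p : Plane × ℝ => Slot.power α p.1 p.2 := by
  unfold Slot.power
  fun_prop

/-- For a fixed gain `g` the spatial integral scales as `(ζ g) ^ (2/α)`; the moment of order `2/α`
of the Gamma law supplies the rest of `DeltaI`. -/
lemma lintegral_one_sub_expNeg_power {α ζ : ℝ} {m : ℕ} (hα : 2 < α) (hm : 0 < m) (hζ : 0 ≤ ζ) :
    ∫⁻ y : Plane, ∫⁻ g, (1 - expNeg (ENNReal.ofReal ζ * Slot.power α y g)) ∂gammaMeasure m m
      = ENNReal.ofReal (Real.pi * ζ ^ (2 / α) * DeltaI m α) := by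
  have hm' : (0 : ℝ) < m := by exact_mod_cast hm
  have : IsProbabilityMeasure (gammaMeasure (m : ℝ) m) := isProbabilityMeasure_gammaMeasure hm' hm'
  have hα0 : 0 < α := by linarith
  have hα3 : 0 < 1 - 2 / α := by rw [sub_pos, div_lt_one hα0]; exact hα
  have hG := Real.Gamma_pos_of_pos hα3
  rw [lintegral_lintegral_swap (Measurable.aemeasurable (by
    refine measurable_const.sub (measurable_expNeg.comp ?_)
    exact (measurable_power α).const_mul _))]
  have h1 : ∀ᵐ g ∂gammaMeasure (m : ℝ) m,
      ∫⁻ y : Plane, (1 - expNeg (ENNReal.ofReal ζ * Slot.power α y g))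
        = ENNReal.ofReal (Real.pi * ζ ^ (2 / α) * Real.Gamma (1 - 2 / α))
          * ENNReal.ofReal (g ^ (2 / α)) := by
    filter_upwards [ae_pos_gammaMeasure (m : ℝ) m] with g hg
    rw [← ENNReal.ofReal_mul (by positivity)]
    have h := lintegral_one_sub_expNeg_norm hα (mul_nonneg hζ hg.le)
    rw [Real.mul_rpow hζ hg.le] at h
    convert! h using 2
    · ext y
      rw [Slot.power, ENNReal.ofReal_mul hζ]
      congr 2
      ring
    · ring
  rw [lintegral_congr_ae h1, lintegral_const_mul _ (by fun_prop),
    lintegral_rpow_gammaMeasure hm' hm' (by positivity), ← ENNReal.ofReal_mul (by positivity),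
    DeltaI]
  congr 1
  ring

/-- The expectation of a functional of two independent random elements is an iterated integral. -/
lemma lintegral_of_indepFun {Ω β γ : Type*} [MeasurableSpace Ω] [MeasurableSpace β]
    [MeasurableSpace γ] {P : Measure Ω} [IsProbabilityMeasure P] {f : Ω → β} {g : Ω → γ}
    (hf : Measurable f) (hg : Measurable g) (hfg : IndepFun f g P) {Φ : β → γ → ℝ≥0∞}
    (hΦ : Measurable fun p : β × γ => Φ p.1 p.2) :
    ∫⁻ ω, Φ (f ω) (g ω) ∂P = ∫⁻ ω, ∫⁻ ω', Φ (f ω) (g ω') ∂P ∂P := by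
  have h := (indepFun_iff_map_prod_eq_prod_map_map hf.aemeasurable hg.aemeasurable).1 hfg
  have h1 := congrArg (fun m => ∫⁻ p, Φ p.1 p.2 ∂m) h
  have : IsProbabilityMeasure (P.map f) := Measure.isProbabilityMeasure_map hf.aemeasurable
  have : IsProbabilityMeasure (P.map g) := Measure.isProbabilityMeasure_map hg.aemeasurable
  rw [lintegral_map hΦ (hf.prodMk hg), lintegral_prod _ hΦ.aemeasurable,
    lintegral_map hΦ.lintegral_prod_right' hf] at h1
  rw [h1]
  refine lintegral_congr fun ω => ?_
  exact lintegral_map (f := fun y => Φ (f ω) y) (hΦ.comp measurable_prodMk_left) hg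

/-! ### Interference on one block and the transform of a single node. -/

/-- Modes, resource blocks and gains of a node. -/
abbrev Mark (M : ℕ) : Type := (Bool × Fin M) × (ℝ × ℝ)

/-- Interference on block `b` of a node at `x` with mark `q`. -/
def interfTerm {M : ℕ} (α : ℝ) (b : Fin M) (x : Plane) (q : Mark M) : ℝ≥0∞ :=
  if q.1 = (true, b) then Slot.power α x q.2.2 else 0

/-- Interference on block `b` of the nodes with label in `K`. -/
def interfAt {M : ℕ} (α : ℝ) (b : Fin M) (K : Set ℕ) (x : ℕ → Plane) (q : ℕ → Mark M) : ℝ≥0∞ :=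
  ∑' j, K.indicator (fun j => interfTerm α b (x j) (q j)) j

lemma measurable_interfTerm {M : ℕ} (α : ℝ) (b : Fin M) :
    Measurable fun p : Plane × Mark M => interfTerm α b p.1 p.2 := by
  refine Measurable.ite ?_ ?_ measurable_const
  · exact (measurable_fst.comp measurable_snd) (measurableSet_singleton _)
  · exact (measurable_power α).comp (f := fun p : Plane × Mark M => (p.1, p.2.2.2)) (by fun_prop)

lemma measurable_interfAt {M : ℕ} (α : ℝ) (b : Fin M) (K : Set ℕ) :
    Measurable fun p : (ℕ → Plane) × (ℕ → Mark M) => interfAt α b K p.1 p.2 := by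
  refine Measurable.tsum fun j => ?_
  by_cases hj : j ∈ K
  · simp only [Set.indicator_of_mem hj]
    exact (measurable_interfTerm α b).comp
      (f := fun p : (ℕ → Plane) × (ℕ → Mark M) => (p.1 j, p.2 j)) (by fun_prop)
  · simp only [Set.indicator_of_notMem hj]
    exact measurable_const

/-- The Laplace transform at `s` of the interference caused on one block by a node at `y`,
if a node uses the block with probability `p`. -/
def nodeLaplace (α : ℝ) (m : ℕ) (p s : ℝ≥0∞) (y : Plane) : ℝ≥0∞ :=
  1 - p * ∫⁻ g, (1 - expNeg (s * Slot.power α y g)) ∂gammaMeasure m m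

lemma measurable_lintegral_expNeg_power (α : ℝ) {m : ℕ} (hm : 0 < m) (s : ℝ≥0∞) :
    Measurable fun y => ∫⁻ g, (1 - expNeg (s * Slot.power α y g)) ∂gammaMeasure m m := by
  have hm' : (0 : ℝ) < m := by exact_mod_cast hm
  have : IsProbabilityMeasure (gammaMeasure (m : ℝ) m) := isProbabilityMeasure_gammaMeasure hm' hm'
  refine Measurable.lintegral_prod_right'
    (f := fun p : Plane × ℝ => 1 - expNeg (s * Slot.power α p.1 p.2)) ?_
  exact measurable_const.sub (measurable_expNeg.comp ((measurable_power α).const_mul _))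

lemma lintegral_expNeg_power_le_one (α : ℝ) {m : ℕ} (hm : 0 < m) (s : ℝ≥0∞) (y : Plane) :
    ∫⁻ g, (1 - expNeg (s * Slot.power α y g)) ∂gammaMeasure m m ≤ 1 := by
  have hm' : (0 : ℝ) < m := by exact_mod_cast hm
  have : IsProbabilityMeasure (gammaMeasure (m : ℝ) m) := isProbabilityMeasure_gammaMeasure hm' hm'
  exact (lintegral_mono fun g => tsub_le_self).trans (by simp)

lemma nodeLaplace_le_one (α : ℝ) (m : ℕ) (p s : ℝ≥0∞) (y : Plane) :
    nodeLaplace α m p s y ≤ 1 := tsub_le_self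

lemma measurable_nodeLaplace (α : ℝ) {m : ℕ} (hm : 0 < m) (p s : ℝ≥0∞) :
    Measurable (nodeLaplace α m p s) :=
  measurable_const.sub ((measurable_lintegral_expNeg_power α hm s).const_mul _)

lemma one_sub_nodeLaplace (α : ℝ) {m : ℕ} (hm : 0 < m) {p : ℝ≥0∞} (hp : p ≤ 1) (s : ℝ≥0∞)
    (y : Plane) : 1 - nodeLaplace α m p s y
      = p * ∫⁻ g, (1 - expNeg (s * Slot.power α y g)) ∂gammaMeasure m m :=
  ENNReal.sub_sub_cancel (by simp)
    (mul_le_one' hp (lintegral_expNeg_power_le_one α hm s y))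

/-- Away from the origin the received power is finite, so its Laplace transform is positive. This
makes `negLog (nodeLaplace …)` finite almost everywhere, as `mecke_expNeg` requires. -/
lemma nodeLaplace_ne_zero (α : ℝ) {m : ℕ} (hm : 0 < m) {p s : ℝ≥0∞} (hp : p ≤ 1) (hs : s ≠ ∞)
    {y : Plane} (hy : y ≠ 0) : nodeLaplace α m p s y ≠ 0 := by
  have hm' : (0 : ℝ) < m := by exact_mod_cast hm
  have : IsProbabilityMeasure (gammaMeasure (m : ℝ) m) := isProbabilityMeasure_gammaMeasure hm' hm'
  have hmeas : Measurable fun g => expNeg (s * Slot.power α y g) :=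
    measurable_expNeg.comp (((measurable_power α).comp measurable_prodMk_left).const_mul _)
  have hle : ∫⁻ g, expNeg (s * Slot.power α y g) ∂gammaMeasure m m ≤ 1 :=
    (lintegral_mono fun g => expNeg_le_one _).trans (by simp)
  have hsub : ∫⁻ g, (1 - expNeg (s * Slot.power α y g)) ∂gammaMeasure m m
      = 1 - ∫⁻ g, expNeg (s * Slot.power α y g) ∂gammaMeasure m m := by
    rw [lintegral_sub hmeas (ne_top_of_le_ne_top (by simp) hle)
      (ae_of_all _ fun g => expNeg_le_one _)]
    simp
  have hpos : ∫⁻ g, expNeg (s * Slot.power α y g) ∂gammaMeasure m m ≠ 0 := by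
    rw [ne_eq, lintegral_eq_zero_iff hmeas]
    intro h
    obtain ⟨g, hg⟩ := h.exists
    simp only [Pi.zero_apply, expNeg_eq_zero] at hg
    refine ENNReal.mul_ne_top hs (ENNReal.mul_ne_top ?_ (by simp)) hg
    simp [ENNReal.rpow_eq_top_iff, hy]
  rw [nodeLaplace, ne_eq, tsub_eq_zero_iff_le, not_le]
  refine lt_of_le_of_lt (mul_le_of_le_one_left' hp) ?_
  rw [hsub]
  exact ENNReal.sub_lt_self (by simp) (by simp) hpos

/-- The exponent of the Laplace transform of the interference on one block. -/
def interfExponent (lam ρ : ℝ) (M mi : ℕ) (α ζ : ℝ) : ℝ :=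
  lam * ρ / M * Real.pi * ζ ^ (2 / α) * DeltaI mi α

lemma DeltaI_pos {m : ℕ} (hm : 0 < m) {α : ℝ} (hα : 2 < α) : 0 < DeltaI m α := by
  have hm' : (0 : ℝ) < m := by exact_mod_cast hm
  have hα0 : 0 < α := by linarith
  have hα3 : 0 < 1 - 2 / α := by rw [sub_pos, div_lt_one hα0]; exact hα
  have h1 := Real.Gamma_pos_of_pos hα3
  have h2 := Real.Gamma_pos_of_pos (show 0 < (m : ℝ) + 2 / α by positivity)
  have h3 := Real.Gamma_pos_of_pos hm'
  unfold DeltaI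
  positivity

lemma lintegral_one_sub_nodeLaplace {lam ρ α ζ : ℝ} {M m : ℕ} (hlam : 0 < lam) (hρ : 0 < ρ)
    (hM : 0 < M) (hα : 2 < α) (hm : 0 < m) (hζ : 0 ≤ ζ)
    (hp : ENNReal.ofReal ρ * (M : ℝ≥0∞)⁻¹ ≤ 1) :
    ∫⁻ y, (1 - nodeLaplace α m (ENNReal.ofReal ρ * (M : ℝ≥0∞)⁻¹) (ENNReal.ofReal ζ) y)
        ∂(ENNReal.ofReal lam • (volume : Measure Plane))
      = ENNReal.ofReal (interfExponent lam ρ M m α ζ) := by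
  have hM' : (0 : ℝ) < M := by exact_mod_cast hM
  have hD := DeltaI_pos hm hα
  simp_rw [one_sub_nodeLaplace α hm hp]
  rw [lintegral_smul_measure, lintegral_const_mul _ (measurable_lintegral_expNeg_power α hm _),
    lintegral_one_sub_expNeg_power hα hm hζ, smul_eq_mul, ← ENNReal.ofReal_natCast M,
    ← ENNReal.ofReal_inv_of_pos hM', ← ENNReal.ofReal_mul hρ.le,
    ← ENNReal.ofReal_mul (by positivity), ← ENNReal.ofReal_mul hlam.le]
  congr 1
  rw [interfExponent]
  ring

instance sigmaFinite_ofReal_smul {E : Type*} [MeasurableSpace E] (μ : Measure E) [SigmaFinite μ]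
    (c : ℝ) : SigmaFinite (ENNReal.ofReal c • μ) :=
  SMul.sigmaFinite (Real.toNNReal c)

/-! ### Law of the interference and its independence from the desired location. -/

namespace Slot.IsRandomHello

variable {Ω : Type*} [MeasurableSpace Ω] {P : Measure Ω} {M ms mi : ℕ} {lam ρ : ℝ} {N : Slot Ω M}

lemma measurable_tx (hN : N.IsRandomHello P lam ρ ms mi) (n : ℕ) : Measurable (N.tx n) :=
  (measurable_fst.comp measurable_fst).comp (hN.measurable_mark n)

lemma measurable_rb (hN : N.IsRandomHello P lam ρ ms mi) (n : ℕ) : Measurable (N.rb n) :=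
  (measurable_snd.comp measurable_fst).comp (hN.measurable_mark n)

lemma measurable_h (hN : N.IsRandomHello P lam ρ ms mi) (n : ℕ) : Measurable (N.h n) :=
  (measurable_fst.comp measurable_snd).comp (hN.measurable_mark n)

lemma measurable_g (hN : N.IsRandomHello P lam ρ ms mi) (n : ℕ) : Measurable (N.g n) :=
  (measurable_snd.comp measurable_snd).comp (hN.measurable_mark n)

lemma measurable_loc (hN : N.IsRandomHello P lam ρ ms mi) : Measurable fun ω n => N.loc n ω :=
  measurable_pi_iff.2 hN.loc_poisson.measurable

lemma measurable_marks (hN : N.IsRandomHello P lam ρ ms mi) : Measurable fun ω n => N.mark n ω :=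
  measurable_pi_iff.2 hN.measurable_mark

lemma measure_block (hN : N.IsRandomHello P lam ρ ms mi) (n : ℕ) (b : Fin M) :
    P {ω | (N.tx n ω, N.rb n ω) = (true, b)} = ENNReal.ofReal ρ * (M : ℝ≥0∞)⁻¹ := by
  have h := (hN.indep_tx_rb n).measure_inter_preimage_eq_mul {true} {b}
    (measurableSet_singleton _) (measurableSet_singleton _)
  rw [← hN.tx_law n, ← hN.rb_law n b]
  rw [show {ω | (N.tx n ω, N.rb n ω) = (true, b)} = N.tx n ⁻¹' {true} ∩ N.rb n ⁻¹' {b} by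
    ext ω; simp, h]
  rfl

lemma measurableSet_block (hN : N.IsRandomHello P lam ρ ms mi) (n : ℕ) (b : Fin M) :
    MeasurableSet {ω | (N.tx n ω, N.rb n ω) = (true, b)} :=
  ((hN.measurable_tx n).prodMk (hN.measurable_rb n)) (measurableSet_singleton (true, b))

lemma measurable_interfAt_comp (hN : N.IsRandomHello P lam ρ ms mi) (α : ℝ) (b : Fin M)
    (K : Set ℕ) : Measurable fun ω => interfAt α b K (fun n => N.loc n ω) (fun n => N.mark n ω) :=
  (measurable_interfAt α b K).comp (hN.measurable_loc.prodMk hN.measurable_marks)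

lemma indep_loc_marks (hN : N.IsRandomHello P lam ρ ms mi) :
    IndepFun (fun ω n => N.loc n ω) (fun ω n => N.mark n ω) P :=
  hN.indep_loc.comp measurable_id measurable_snd

variable [IsProbabilityMeasure P]

lemma laplace_interfTerm (hN : N.IsRandomHello P lam ρ ms mi) (α : ℝ) (s : ℝ≥0∞) (n : ℕ)
    (b : Fin M) (y : Plane) :
    ∫⁻ ω, expNeg (s * interfTerm α b y (N.mark n ω)) ∂P
      = nodeLaplace α mi (ENNReal.ofReal ρ * (M : ℝ≥0∞)⁻¹) s y := by
  set φ : ℝ → ℝ≥0∞ := fun g => 1 - expNeg (s * Slot.power α y g) with hφ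
  have hφm : Measurable φ := measurable_const.sub
    (measurable_expNeg.comp (((measurable_power α).comp measurable_prodMk_left).const_mul _))
  set ι : Bool × Fin M → ℝ≥0∞ := ({(true, b)} : Set _).indicator 1 with hι
  have hιm : Measurable ι := measurable_one.indicator (measurableSet_singleton _)
  -- In the form `1 - 1_{block} (1 - exp (-s P))` the block choice and the gain separate into a
  -- product of independent factors.
  have h1 (ω : Ω) : expNeg (s * interfTerm α b y (N.mark n ω))
      = 1 - ι (N.tx n ω, N.rb n ω) * φ (N.g n ω) := by
    by_cases h : (N.tx n ω, N.rb n ω) = (true, b)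
    · simp only [interfTerm, mark, h, hι, hφ, if_true, Set.mem_singleton_iff,
        Set.indicator_of_mem, Pi.one_apply, one_mul]
      exact (ENNReal.sub_sub_cancel (by simp) (expNeg_le_one _)).symm
    · have h' : (N.tx n ω, N.rb n ω) ∉ ({(true, b)} : Set (Bool × Fin M)) := h
      have h0 : interfTerm α b y (N.mark n ω) = 0 := if_neg h
      rw [h0, hι, Set.indicator_of_notMem h']
      simp
  have hle (ω : Ω) : ι (N.tx n ω, N.rb n ω) * φ (N.g n ω) ≤ 1 :=
    mul_le_one' (Set.indicator_le (fun _ _ => le_rfl) _ |>.trans (by simp)) tsub_le_self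
  have hm : Measurable fun ω => ι (N.tx n ω, N.rb n ω) * φ (N.g n ω) :=
    (hιm.comp ((hN.measurable_tx n).prodMk (hN.measurable_rb n))).mul
      (hφm.comp (hN.measurable_g n))
  have h2 : ∫⁻ ω, ι (N.tx n ω, N.rb n ω) * φ (N.g n ω) ∂P
      = ENNReal.ofReal ρ * (M : ℝ≥0∞)⁻¹ * ∫⁻ g, φ g ∂gammaMeasure mi mi := by
    have hind := (hN.indep_fading n).comp hιm (hφm.comp measurable_snd)
    have := lintegral_mul_eq_lintegral_mul_lintegral_of_indepFun''
      (f := fun ω => ι (N.tx n ω, N.rb n ω)) (g := fun ω => φ (N.g n ω)) (μ := P)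
      (hιm.comp ((hN.measurable_tx n).prodMk (hN.measurable_rb n))).aemeasurable
      (hφm.comp (hN.measurable_g n)).aemeasurable hind
    rw [this, (hN.g_law n).lintegral_comp hφm.aemeasurable, ← hN.measure_block n b,
      ← lintegral_indicator_one (hN.measurableSet_block n b)]
    rfl
  simp_rw [h1]
  rw [lintegral_sub hm _ (ae_of_all _ hle), h2]
  · simp [nodeLaplace, hφ]
  · exact ne_top_of_le_ne_top (by simp) ((lintegral_mono hle).trans (by simp) : _ ≤ (1 : ℝ≥0∞))

/-- The Laplace transform of the interference for given node locations. -/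
lemma laplace_interfAt (hN : N.IsRandomHello P lam ρ ms mi) (α : ℝ) (s : ℝ≥0∞)
    (b : Fin M) (K : Set ℕ) (x : ℕ → Plane) :
    ∫⁻ ω, expNeg (s * interfAt α b K x (fun n => N.mark n ω)) ∂P
      = expNeg (∑' j, K.indicator (fun j => negLog
          (nodeLaplace α mi (ENNReal.ofReal ρ * (M : ℝ≥0∞)⁻¹) s (x j))) j) := by
  have hm (j : ℕ) : Measurable fun q : Mark M =>
      K.indicator (fun j => s * interfTerm α b (x j) q) j := by
    by_cases hj : j ∈ K
    · simp only [Set.indicator_of_mem hj]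
      exact ((measurable_interfTerm α b).comp measurable_prodMk_left).const_mul s
    · simp only [Set.indicator_of_notMem hj]
      exact measurable_const
  have h := lintegral_expNeg_tsum (P := P)
    (Z := fun j ω => K.indicator (fun j => s * interfTerm α b (x j) (N.mark j ω)) j)
    (fun j => (hm j).comp (hN.measurable_mark j))
    (hN.indep_nodes.comp (fun j q => K.indicator (fun j => s * interfTerm α b (x j) q) j) hm)
  have h1 (ω : Ω) : ∑' j, K.indicator (fun j => s * interfTerm α b (x j) (N.mark j ω)) j
      = s * interfAt α b K x (fun n => N.mark n ω) := by
    rw [interfAt, ← ENNReal.tsum_mul_left]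
    exact tsum_congr fun j => by by_cases hj : j ∈ K <;> simp [hj]
  simp_rw [h1] at h
  rw [h]
  congr 1
  refine tsum_congr fun j => ?_
  by_cases hj : j ∈ K
  · simp only [Set.indicator_of_mem hj]
    rw [hN.laplace_interfTerm]
  · simp only [Set.indicator_of_notMem hj]
    simp [negLog_one]

/-- The law of the interference on a block. -/
def interfLaw (_ : N.IsRandomHello P lam ρ ms mi) (α : ℝ) (b : Fin M) : Measure ℝ≥0∞ :=
  P.map fun ω => interfAt α b Set.univ (fun n => N.loc n ω) (fun n => N.mark n ω)

lemma isProbabilityMeasure_interfLaw (hN : N.IsRandomHello P lam ρ ms mi) (α : ℝ) (b : Fin M) :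
    IsProbabilityMeasure (hN.interfLaw α b) :=
  Measure.isProbabilityMeasure_map (hN.measurable_interfAt_comp α b Set.univ).aemeasurable

lemma block_prob_le_one (hN : N.IsRandomHello P lam ρ ms mi) (hM : 0 < M) :
    ENNReal.ofReal ρ * (M : ℝ≥0∞)⁻¹ ≤ 1 := by
  rw [← hN.measure_block 0 ⟨0, hM⟩]
  exact prob_le_one

/-- Averaging the marks for fixed locations leaves `exp (-∑ u (X j))` with `u = negLog nodeLaplace`,
and the Poisson Laplace functional returns `∫ (1 - nodeLaplace)`. -/
lemma laplace_interfLaw (hN : N.IsRandomHello P lam ρ ms mi) (hmi : 0 < mi) (hlam : 0 < lam)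
    (hρ : 0 < ρ) {α : ℝ} (hα : 2 < α) (b : Fin M) {ζ : ℝ} (hζ : 0 ≤ ζ) :
    ∫⁻ t, expNeg (ENNReal.ofReal ζ * t) ∂hN.interfLaw α b
      = expNeg (ENNReal.ofReal (interfExponent lam ρ M mi α ζ)) := by
  have hM : 0 < M := b.pos
  have hp := hN.block_prob_le_one hM
  rw [interfLaw, lintegral_map (by fun_prop) (hN.measurable_interfAt_comp α b Set.univ),
    lintegral_of_indepFun hN.measurable_loc hN.measurable_marks hN.indep_loc_marks
      (Φ := fun x q => expNeg (ENNReal.ofReal ζ * interfAt α b Set.univ x q))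
      (measurable_expNeg.comp ((measurable_interfAt α b Set.univ).const_mul _))]
  simp_rw [hN.laplace_interfAt, Set.indicator_univ]
  rw [hN.loc_poisson.laplace (u := fun y => negLog (nodeLaplace α mi
      (ENNReal.ofReal ρ * (M : ℝ≥0∞)⁻¹) (ENNReal.ofReal ζ) y))
    (measurable_negLog.comp (measurable_nodeLaplace α hmi _ (ENNReal.ofReal ζ)))]
  simp_rw [expNeg_negLog (nodeLaplace_le_one _ _ _ _ _)]
  rw [lintegral_one_sub_nodeLaplace hlam hρ hM hα hmi hζ hp]

/-- Joint laws of the location of a node and the interference for its packet, summed over all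
nodes. -/
lemma sum_map_loc_interf (hN : N.IsRandomHello P lam ρ ms mi) (hmi : 0 < mi) (hlam : 0 < lam)
    (hρ : 0 < ρ) {α : ℝ} (hα : 2 < α) (b : Fin M) :
    (Measure.sum fun i => P.map fun ω =>
      (N.loc i ω, interfAt α b {i}ᶜ (fun n => N.loc n ω) (fun n => N.mark n ω)))
      = (ENNReal.ofReal lam • (volume : Measure Plane)).prod (hN.interfLaw α b) := by
  have hM : 0 < M := b.pos
  have hp := hN.block_prob_le_one hM
  have hprob := hN.isProbabilityMeasure_interfLaw α b
  set Λ := ENNReal.ofReal lam • (volume : Measure Plane) with hΛ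
  have hσ : SigmaFinite Λ := inferInstance
  set κ := hN.interfLaw α b with hκ
  set m : Measure (Plane × ℝ≥0∞) := Measure.sum fun i => P.map fun ω =>
      (N.loc i ω, interfAt α b {i}ᶜ (fun n => N.loc n ω) (fun n => N.mark n ω)) with hm
  have hpair (i : ℕ) : Measurable fun ω =>
      (N.loc i ω, interfAt α b {i}ᶜ (fun n => N.loc n ω) (fun n => N.mark n ω)) :=
    (hN.loc_poisson.measurable i).prodMk (hN.measurable_interfAt_comp α b {i}ᶜ)
  -- Mecke's formula, after averaging the marks of the nodes other than `i`: the right side is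
  -- already a product of a factor in `A` and a factor in `ζ`.
  have hlap {A : Set Plane} (hA : MeasurableSet A) {ζ : ℝ} (hζ : 0 ≤ ζ) :
      ∫⁻ p, A.indicator 1 p.1 * expNeg (ENNReal.ofReal ζ * p.2) ∂m
        = Λ A * expNeg (ENNReal.ofReal (interfExponent lam ρ M mi α ζ)) := by
    have hAm : Measurable (A.indicator (1 : Plane → ℝ≥0∞)) := measurable_one.indicator hA
    have hu : Measurable fun y => negLog
        (nodeLaplace α mi (ENNReal.ofReal ρ * (M : ℝ≥0∞)⁻¹) (ENNReal.ofReal ζ) y) :=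
      measurable_negLog.comp (measurable_nodeLaplace α hmi _ _)
    have hne : ∀ᵐ y ∂Λ, y ≠ 0 := by simp [ae_iff, hΛ]
    have hmecke := hN.loc_poisson.mecke_expNeg hu (by
      filter_upwards [hne] with y hy
      rw [ne_eq, negLog_eq_top (nodeLaplace_le_one _ _ _ _ _)]
      exact nodeLaplace_ne_zero α hmi hp (by simp) hy) hA
    simp_rw [expNeg_negLog (nodeLaplace_le_one _ _ _ _ _)] at hmecke
    rw [lintegral_one_sub_nodeLaplace hlam hρ hM hα hmi hζ hp] at hmecke
    rw [← hmecke, hm, lintegral_sum_measure]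
    refine tsum_congr fun i => ?_
    rw [lintegral_map (by fun_prop) (hpair i)]
    have hΦ : Measurable fun p : (ℕ → Plane) × (ℕ → Mark M) =>
        A.indicator 1 (p.1 i) * expNeg (ENNReal.ofReal ζ * interfAt α b {i}ᶜ p.1 p.2) :=
      (hAm.comp ((measurable_pi_apply i).comp measurable_fst)).mul
        (measurable_expNeg.comp ((measurable_interfAt α b {i}ᶜ).const_mul _))
    rw [lintegral_of_indepFun hN.measurable_loc hN.measurable_marks hN.indep_loc_marks
      (Φ := fun x q => A.indicator 1 (x i) * expNeg (ENNReal.ofReal ζ * interfAt α b {i}ᶜ x q)) hΦ]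
    refine lintegral_congr fun ω => ?_
    have hmq : Measurable fun ω' => expNeg (ENNReal.ofReal ζ
        * interfAt α b {i}ᶜ (fun n => N.loc n ω) fun n => N.mark n ω') :=
      measurable_expNeg.comp (((measurable_interfAt α b {i}ᶜ).comp (measurable_prodMk_left.comp
        hN.measurable_marks)).const_mul _)
    rw [lintegral_const_mul _ hmq, hN.laplace_interfAt]
    congr 2
    refine tsum_congr fun j => ?_
    by_cases hj : j = i <;> simp [hj]
  -- For `A` of finite mass both sides are finite measures on `[0, ∞]` with the same Laplace
  -- transform.
  have hrect {A : Set Plane} (hA : MeasurableSet A) (hA' : Λ A ≠ ∞) :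
      (m.restrict (A ×ˢ Set.univ)).map Prod.snd = Λ A • κ := by
    have hlap' {ζ : ℝ} (hζ : 0 ≤ ζ) :
        ∫⁻ t, expNeg (ENNReal.ofReal ζ * t) ∂((m.restrict (A ×ˢ Set.univ)).map Prod.snd)
          = Λ A * expNeg (ENNReal.ofReal (interfExponent lam ρ M mi α ζ)) := by
      rw [lintegral_map (by fun_prop) measurable_snd,
        ← lintegral_indicator (hA.prod MeasurableSet.univ), ← hlap hA hζ]
      refine lintegral_congr fun p => ?_
      by_cases h : p.1 ∈ A <;> simp [h, Set.indicator]
    have hf1 : IsFiniteMeasure ((m.restrict (A ×ˢ Set.univ)).map Prod.snd) := by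
      refine ⟨?_⟩
      have h := hlap' le_rfl
      simp only [ENNReal.ofReal_zero, zero_mul, expNeg_zero, lintegral_const, one_mul] at h
      rw [h]
      exact ENNReal.mul_lt_top hA'.lt_top (expNeg_ne_top _).lt_top
    have hf2 : IsFiniteMeasure (Λ A • κ) := Measure.smul_finite _ hA'
    refine measure_ext_of_laplace fun n => ?_
    rw [← ENNReal.ofReal_natCast, hlap' n.cast_nonneg, lintegral_smul_measure,
      hN.laplace_interfLaw hmi hlam hρ hα b n.cast_nonneg, smul_eq_mul]
  -- For fixed `T` both sides are measures in `A`, so agreement on sets of finite mass extends to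
  -- all `A`, as `Measure.prod_eq` needs.
  have hfst {T : Set ℝ≥0∞} (hT : MeasurableSet T) :
      (m.restrict (Set.univ ×ˢ T)).map Prod.fst = κ T • Λ := by
    refine measure_ext_of_finite (Λ := Λ) fun A hA hA' => ?_
    have h := congrArg (fun μ => μ T) (hrect hA hA')
    simp only [Measure.smul_apply, smul_eq_mul] at h
    rw [Measure.map_apply measurable_snd hT, Measure.restrict_apply (measurable_snd hT)] at h
    rw [Measure.map_apply measurable_fst hA, Measure.restrict_apply (measurable_fst hA),
      Measure.smul_apply, smul_eq_mul, mul_comm, ← h]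
    congr 1
    ext p
    simp [and_comm]
  refine (Measure.prod_eq fun A T hA hT => ?_).symm
  have h := congrArg (fun μ => μ A) (hfst hT)
  simp only [Measure.smul_apply, smul_eq_mul] at h
  rw [Measure.map_apply measurable_fst hA, Measure.restrict_apply (measurable_fst hA)] at h
  rw [mul_comm, ← h]
  congr 1
  ext p
  simp

end Slot.IsRandomHello

/-! ### Discovery events and the mean number of discovered nodes. -/

/-- Locations, interferences and gains for which the SINR exceeds `ξ`. -/
def decodeSet (α σ ξ : ℝ) : Set ((Plane × ℝ≥0∞) × ℝ) :=
  {p | ENNReal.ofReal ξ < Slot.power α p.1.1 p.2 / (p.1.2 + ENNReal.ofReal (σ ^ 2))}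

lemma measurableSet_decodeSet (α σ ξ : ℝ) : MeasurableSet (decodeSet α σ ξ) := by
  refine measurableSet_lt measurable_const (Measurable.div ?_ ?_)
  · exact (measurable_power α).comp
      (f := fun p : (Plane × ℝ≥0∞) × ℝ => (p.1.1, p.2)) (by fun_prop)
  · fun_prop

/-- The probability that the packet of a node at `p.1` is decoded if the interference is `p.2`. -/
def decodeProb (m : ℕ) (α σ ξ : ℝ) (p : Plane × ℝ≥0∞) : ℝ≥0∞ :=
  gammaMeasure m m (Prod.mk p ⁻¹' decodeSet α σ ξ)

lemma measurable_decodeProb {m : ℕ} (hm : 0 < m) (α σ ξ : ℝ) :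
    Measurable (decodeProb m α σ ξ) := by
  have hm' : (0 : ℝ) < m := by exact_mod_cast hm
  have : IsProbabilityMeasure (gammaMeasure (m : ℝ) m) := isProbabilityMeasure_gammaMeasure hm' hm'
  exact measurable_measure_prodMk_left (measurableSet_decodeSet α σ ξ)

/-- Indicator of the event that node `i` transmits on block `b` and its SINR exceeds `ξ`. -/
def decodeInd {M : ℕ} (α σ ξ : ℝ) (i : ℕ) (b : Fin M) (x : ℕ → Plane) (q : ℕ → Mark M) : ℝ≥0∞ :=
  ({(true, b)} : Set (Bool × Fin M)).indicator 1 (q i).1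
    * (decodeSet α σ ξ).indicator 1 ((x i, interfAt α b {i}ᶜ x q), (q i).2.1)

lemma measurable_decodeInd {M : ℕ} (α σ ξ : ℝ) (i : ℕ) (b : Fin M) :
    Measurable fun p : (ℕ → Plane) × (ℕ → Mark M) => decodeInd α σ ξ i b p.1 p.2 := by
  have h1 : Measurable fun p : (ℕ → Plane) × (ℕ → Mark M) => (p.2 i).1 := by fun_prop
  have h2 : Measurable fun p : (ℕ → Plane) × (ℕ → Mark M) =>
      ((p.1 i, interfAt α b {i}ᶜ p.1 p.2), (p.2 i).2.1) :=
    (Measurable.prodMk (by fun_prop) (measurable_interfAt α b {i}ᶜ)).prodMk (by fun_prop)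
  exact ((measurable_one.indicator (measurableSet_singleton _)).comp h1).mul
    ((measurable_one.indicator (measurableSet_decodeSet α σ ξ)).comp h2)

/-- Only the marks with label in `K` have to be measurable, so the lemma applies to the σ-algebra
generated by the marks other than that of node `i`. -/
lemma measurable_interfAt_marks {Ω : Type*} [MeasurableSpace Ω] {M : ℕ} (α : ℝ) (b : Fin M)
    {K : Set ℕ} (x : ℕ → Plane) {q : ℕ → Ω → Mark M} (hq : ∀ j ∈ K, Measurable (q j)) :
    Measurable fun ω => interfAt α b K x (fun n => q n ω) := by
  refine Measurable.tsum fun j => ?_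
  by_cases hj : j ∈ K
  · simp only [Set.indicator_of_mem hj]
    exact ((measurable_interfTerm α b).comp measurable_prodMk_left).comp (hq j hj)
  · simp only [Set.indicator_of_notMem hj]
    exact measurable_const

namespace Slot

variable {Ω : Type*} {M : ℕ}

/-- The event that node `i` is discovered. -/
def discoverEvent (N : Slot Ω M) (α σ ξ : ℝ) (i : ℕ) : Set Ω :=
  {ω | N.tx₀ ω = false ∧ N.tx i ω = true ∧ ENNReal.ofReal ξ < N.sinr α σ i ω}

lemma interference_eq (N : Slot Ω M) (α : ℝ) (i : ℕ) (ω : Ω) :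
    N.interference α i ω
      = interfAt α (N.rb i ω) {i}ᶜ (fun n => N.loc n ω) (fun n => N.mark n ω) := by
  rw [interference, interfAt]
  refine tsum_congr fun j => ?_
  by_cases hj : j = i
  · simp [hj]
  · simp [hj, interfTerm, mark]

/-- A node uses exactly one block, so at most one summand survives. The sum replaces the random
block in the interference by a deterministic one. -/
lemma indicator_discoverEvent (N : Slot Ω M) (α σ ξ : ℝ) (i : ℕ) (ω : Ω) :
    (N.discoverEvent α σ ξ i).indicator 1 ω
      = ({false} : Set Bool).indicator (1 : Bool → ℝ≥0∞) (N.tx₀ ω)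
        * ∑ b, decodeInd α σ ξ i b (fun n => N.loc n ω) (fun n => N.mark n ω) := by
  classical
  have h0 (b : Fin M) (hb : b ≠ N.rb i ω) :
      decodeInd α σ ξ i b (fun n => N.loc n ω) (fun n => N.mark n ω) = 0 := by
    rw [decodeInd, Set.indicator_of_notMem, zero_mul]
    simp [mark, hb.symm]
  rw [Finset.sum_eq_single (N.rb i ω) (fun b _ hb => h0 b hb) (by simp)]
  have hW : ((N.loc i ω, interfAt α (N.rb i ω) {i}ᶜ (fun n => N.loc n ω)
      (fun n => N.mark n ω)), (N.mark i ω).2.1) ∈ decodeSet α σ ξ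
        ↔ ENNReal.ofReal ξ < N.sinr α σ i ω := by
    rw [← interference_eq]
    rfl
  have hB : (N.mark i ω).1 ∈ ({(true, N.rb i ω)} : Set (Bool × Fin M))
      ↔ N.tx i ω = true := by
    simp [mark]
  simp only [decodeInd, Set.indicator_apply, hW, hB, discoverEvent, Set.mem_ofPred_eq,
    Set.mem_singleton_iff, Pi.one_apply]
  by_cases h1 : N.tx₀ ω = false <;> by_cases h2 : N.tx i ω = true <;>
    by_cases h3 : ENNReal.ofReal ξ < N.sinr α σ i ω <;> simp [h1, h2, h3]

lemma discovered_eq_tsum (N : Slot Ω M) (α σ ξ : ℝ) (ω : Ω) :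
    (N.discovered α σ ξ ω : ℝ≥0∞) = ∑' i, (N.discoverEvent α σ ξ i).indicator 1 ω := by
  rw [discovered, ← ENNReal.tsum_set_one, tsum_subtype _ (fun _ => (1 : ℝ≥0∞))]
  rfl

namespace IsRandomHello

variable [MeasurableSpace Ω] {P : Measure Ω} {ms mi : ℕ} {lam ρ : ℝ} {N : Slot Ω M}

lemma measurableSet_discoverEvent (hN : N.IsRandomHello P lam ρ ms mi) (α σ ξ : ℝ) (i : ℕ) :
    MeasurableSet (N.discoverEvent α σ ξ i) := by
  have hm : Measurable ((N.discoverEvent α σ ξ i).indicator (1 : Ω → ℝ≥0∞)) := by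
    rw [funext (N.indicator_discoverEvent α σ ξ i)]
    refine ((measurable_one.indicator (measurableSet_singleton _)).comp hN.measurable_tx₀).mul
      (Finset.measurable_fun_sum _ fun b _ => ?_)
    exact (measurable_decodeInd α σ ξ i b).comp (hN.measurable_loc.prodMk hN.measurable_marks)
  have h : N.discoverEvent α σ ξ i
      = (N.discoverEvent α σ ξ i).indicator (1 : Ω → ℝ≥0∞) ⁻¹' {1} := by
    ext ω
    by_cases h : ω ∈ N.discoverEvent α σ ξ i <;> simp [h]
  rw [h]
  exact hm (measurableSet_singleton _)

lemma measurable_discovered (hN : N.IsRandomHello P lam ρ ms mi) (α σ ξ : ℝ) :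
    Measurable (N.discovered α σ ξ) := by
  refine measurable_encard.comp (measurable_set_iff.2 fun i => ?_)
  exact measurableSet_setOfPred.1 (hN.measurableSet_discoverEvent α σ ξ i)

/-- The interference at other nodes is independent of the mark of node `i`. -/
lemma indep_interf_mark (hN : N.IsRandomHello P lam ρ ms mi) (α : ℝ) (i : ℕ) (b : Fin M)
    (x : ℕ → Plane) :
    IndepFun (fun ω => interfAt α b {i}ᶜ x (fun n => N.mark n ω)) (N.mark i) P := by
  have h := indep_iSup_of_disjoint (S := {i}ᶜ) (T := {i})
    (fun j => (hN.measurable_mark j).comap_le) hN.indep_nodes.iIndep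
    (disjoint_compl_left)
  refine indep_of_indep_of_le_right (indep_of_indep_of_le_left h ?_) ?_
  · refine Measurable.comap_le (@measurable_interfAt_marks Ω
      (⨆ j ∈ ({i}ᶜ : Set ℕ), MeasurableSpace.comap (N.mark j) inferInstance) M α b _ x
      (fun n => N.mark n) fun j hj => ?_)
    exact (comap_measurable (N.mark j)).mono
      (le_iSup₂ (f := fun j (_ : j ∈ ({i}ᶜ : Set ℕ)) =>
        MeasurableSpace.comap (N.mark j) inferInstance) j hj) le_rfl
  · exact le_iSup₂ (f := fun j (_ : j ∈ ({i} : Set ℕ)) =>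
      MeasurableSpace.comap (N.mark j) inferInstance) i rfl

variable [IsProbabilityMeasure P]

lemma measure_tx₀_false (hN : N.IsRandomHello P lam ρ ms mi) (hρ : 0 < ρ) :
    P {ω | N.tx₀ ω = false} = ENNReal.ofReal (1 - ρ) := by
  have hm : MeasurableSet {ω | N.tx₀ ω = true} :=
    hN.measurable_tx₀ (measurableSet_singleton true)
  have h : {ω | N.tx₀ ω = false} = {ω | N.tx₀ ω = true}ᶜ := by ext ω; simp
  rw [h, prob_compl_eq_one_sub hm, hN.tx₀_law, ENNReal.ofReal_sub _ hρ.le, ENNReal.ofReal_one]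

/-- For fixed locations the interference omits node `i`, hence is independent of its mark; within
the mark, mode and block are independent of the gain `h`. -/
lemma lintegral_decodeInd_marks (hN : N.IsRandomHello P lam ρ ms mi) (α σ ξ : ℝ)
    (i : ℕ) (b : Fin M) (x : ℕ → Plane) :
    ∫⁻ ω, decodeInd α σ ξ i b x (fun n => N.mark n ω) ∂P
      = ENNReal.ofReal ρ * (M : ℝ≥0∞)⁻¹
        * ∫⁻ ω, decodeProb ms α σ ξ (x i, interfAt α b {i}ᶜ x (fun n => N.mark n ω)) ∂P := by
  set J : Ω → ℝ≥0∞ := fun ω => interfAt α b {i}ᶜ x (fun n => N.mark n ω) with hJ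
  have hJm : Measurable J :=
    (measurable_interfAt α b {i}ᶜ).comp (measurable_prodMk_left.comp hN.measurable_marks)
  have hWm : Measurable ((decodeSet α σ ξ).indicator (1 : (Plane × ℝ≥0∞) × ℝ → ℝ≥0∞)) :=
    measurable_one.indicator (measurableSet_decodeSet α σ ξ)
  have hBm : Measurable (({(true, b)} : Set (Bool × Fin M)).indicator (1 : Bool × Fin M → ℝ≥0∞)) :=
    measurable_one.indicator (measurableSet_singleton _)
  have hΦ : Measurable fun p : ℝ≥0∞ × Mark M =>
      ({(true, b)} : Set (Bool × Fin M)).indicator (1 : Bool × Fin M → ℝ≥0∞) p.2.1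
        * (decodeSet α σ ξ).indicator 1 ((x i, p.1), p.2.2.1) :=
    (hBm.comp (f := fun p : ℝ≥0∞ × Mark M => p.2.1) (by fun_prop)).mul (hWm.comp
      (f := fun p : ℝ≥0∞ × Mark M => ((x i, p.1), p.2.2.1)) (by fun_prop))
  have h1 := lintegral_of_indepFun hJm (hN.measurable_mark i) (hN.indep_interf_mark α i b x)
    (Φ := fun t q => ({(true, b)} : Set (Bool × Fin M)).indicator (1 : Bool × Fin M → ℝ≥0∞) q.1
        * (decodeSet α σ ξ).indicator 1 ((x i, t), q.2.1)) hΦ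
  have hpm : Measurable fun ω => decodeProb ms α σ ξ (x i, J ω) := by
    have hms : IsProbabilityMeasure (gammaMeasure (ms : ℝ) ms) := by
      rw [← (hN.h_law i).isProbabilityMeasure_iff]
      infer_instance
    exact (measurable_measure_prodMk_left (measurableSet_decodeSet α σ ξ)).comp
      (measurable_const.prodMk hJm)
  rw [← lintegral_const_mul _ hpm]
  refine h1.trans (lintegral_congr fun ω => ?_)
  have hWx : Measurable fun a : ℝ => (decodeSet α σ ξ).indicator (1 : (Plane × ℝ≥0∞) × ℝ → ℝ≥0∞) ((x i, J ω), a) :=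
    hWm.comp measurable_prodMk_left
  have hind := (hN.indep_fading i).comp hBm (hWx.comp measurable_fst)
  have h2 := lintegral_mul_eq_lintegral_mul_lintegral_of_indepFun''
    (f := fun ω' => ({(true, b)} : Set (Bool × Fin M)).indicator (1 : Bool × Fin M → ℝ≥0∞)
      (N.tx i ω', N.rb i ω'))
    (g := fun ω' => (decodeSet α σ ξ).indicator (1 : (Plane × ℝ≥0∞) × ℝ → ℝ≥0∞) ((x i, J ω), N.h i ω')) (μ := P)
    (hBm.comp ((hN.measurable_tx i).prodMk (hN.measurable_rb i))).aemeasurable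
    (hWx.comp (hN.measurable_h i)).aemeasurable hind
  refine h2.trans ?_
  congr 1
  · rw [← hN.measure_block i b, ← lintegral_indicator_one (hN.measurableSet_block i b)]
    rfl
  · rw [(hN.h_law i).lintegral_comp
      (f := fun a => (decodeSet α σ ξ).indicator (1 : (Plane × ℝ≥0∞) × ℝ → ℝ≥0∞) ((x i, J ω), a))
      hWx.aemeasurable, decodeProb, ← lintegral_indicator_one
        (measurable_prodMk_left (measurableSet_decodeSet α σ ξ))]
    rfl

lemma measure_discoverEvent (hN : N.IsRandomHello P lam ρ ms mi) (hms : 0 < ms) (hρ : 0 < ρ)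
    (α σ ξ : ℝ) (i : ℕ) :
    P (N.discoverEvent α σ ξ i) = ENNReal.ofReal (1 - ρ) *
      ∑ b : Fin M, ENNReal.ofReal ρ * (M : ℝ≥0∞)⁻¹ * ∫⁻ ω, decodeProb ms α σ ξ
        (N.loc i ω, interfAt α b {i}ᶜ (fun n => N.loc n ω) (fun n => N.mark n ω)) ∂P := by
  have h0m : Measurable (({false} : Set Bool).indicator (1 : Bool → ℝ≥0∞)) :=
    measurable_one.indicator (measurableSet_singleton _)
  have hdm (b : Fin M) (x : ℕ → Plane) :
      Measurable fun q : ℕ → Mark M => decodeInd α σ ξ i b x q :=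
    (measurable_decodeInd α σ ξ i b).comp measurable_prodMk_left
  have hsm (x : ℕ → Plane) : Measurable fun q : ℕ → Mark M => ∑ b, decodeInd α σ ξ i b x q :=
    Finset.measurable_fun_sum _ fun b _ => hdm b x
  have hΦ : Measurable fun p : (ℕ → Plane) × (Bool × (ℕ → Mark M)) =>
      ({false} : Set Bool).indicator (1 : Bool → ℝ≥0∞) p.2.1
        * ∑ b, decodeInd α σ ξ i b p.1 p.2.2 := by
    refine (h0m.comp (by fun_prop)).mul (Finset.measurable_fun_sum _ fun b _ => ?_)
    exact (measurable_decodeInd α σ ξ i b).comp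
      (f := fun p : (ℕ → Plane) × (Bool × (ℕ → Mark M)) => (p.1, p.2.2)) (by fun_prop)
  have h1 := lintegral_of_indepFun hN.measurable_loc
    (hN.measurable_tx₀.prodMk hN.measurable_marks) hN.indep_loc
    (Φ := fun x p => ({false} : Set Bool).indicator (1 : Bool → ℝ≥0∞) p.1
        * ∑ b, decodeInd α σ ξ i b x p.2) hΦ
  have h2 (x : ℕ → Plane) : ∫⁻ ω, ({false} : Set Bool).indicator (1 : Bool → ℝ≥0∞) (N.tx₀ ω)
        * ∑ b, decodeInd α σ ξ i b x (fun n => N.mark n ω) ∂P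
      = ENNReal.ofReal (1 - ρ) * ∑ b : Fin M, ENNReal.ofReal ρ * (M : ℝ≥0∞)⁻¹
        * ∫⁻ ω, decodeProb ms α σ ξ (x i, interfAt α b {i}ᶜ x (fun n => N.mark n ω)) ∂P := by
    have h3 := lintegral_mul_eq_lintegral_mul_lintegral_of_indepFun''
      (f := fun ω => ({false} : Set Bool).indicator (1 : Bool → ℝ≥0∞) (N.tx₀ ω))
      (g := fun ω => ∑ b, decodeInd α σ ξ i b x (fun n => N.mark n ω)) (μ := P)
      (h0m.comp hN.measurable_tx₀).aemeasurable
      ((hsm x).comp hN.measurable_marks).aemeasurable (hN.indep_tx₀.comp h0m (hsm x))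
    have hdm' (b : Fin M) : Measurable fun ω => decodeInd α σ ξ i b x (fun n => N.mark n ω) :=
      (hdm b x).comp hN.measurable_marks
    rw [h3, lintegral_finsetSum _ fun b _ => hdm' b]
    congr 1
    · have hm0 : MeasurableSet {ω | N.tx₀ ω = false} :=
        hN.measurable_tx₀ (measurableSet_singleton false)
      rw [← hN.measure_tx₀_false hρ, ← lintegral_indicator_one hm0]
      rfl
    · exact Finset.sum_congr rfl fun b _ => hN.lintegral_decodeInd_marks α σ ξ i b x
  have hpm (b : Fin M) : Measurable fun p : (ℕ → Plane) × (ℕ → Mark M) =>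
      decodeProb ms α σ ξ (p.1 i, interfAt α b {i}ᶜ p.1 p.2) :=
    (measurable_decodeProb hms α σ ξ).comp
      (Measurable.prodMk (by fun_prop) (measurable_interfAt α b {i}ᶜ))
  have hpm' (b : Fin M) : Measurable fun ω : Ω => ∫⁻ ω', decodeProb ms α σ ξ
      (N.loc i ω, interfAt α b {i}ᶜ (fun n => N.loc n ω) (fun n => N.mark n ω')) ∂P := by
    refine Measurable.lintegral_prod_right' (f := fun p : Ω × Ω => decodeProb ms α σ ξ
      (N.loc i p.1, interfAt α b {i}ᶜ (fun n => N.loc n p.1) (fun n => N.mark n p.2))) ?_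
    exact (hpm b).comp (f := fun p : Ω × Ω => (fun n => N.loc n p.1, fun n => N.mark n p.2))
      ((hN.measurable_loc.comp measurable_fst).prodMk (hN.measurable_marks.comp measurable_snd))
  rw [← lintegral_indicator_one (hN.measurableSet_discoverEvent α σ ξ i),
    lintegral_congr (N.indicator_discoverEvent α σ ξ i)]
  refine h1.trans ?_
  rw [lintegral_congr fun ω => h2 (fun n => N.loc n ω), lintegral_const_mul _
    (Finset.measurable_fun_sum _ fun b _ => (hpm' b).const_mul _),
    lintegral_finsetSum _ fun b _ => (hpm' b).const_mul _]
  congr 1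
  refine Finset.sum_congr rfl fun b _ => ?_
  rw [lintegral_const_mul _ (hpm' b)]
  congr 1
  exact (lintegral_of_indepFun hN.measurable_loc hN.measurable_marks hN.indep_loc_marks
    (Φ := fun x q => decodeProb ms α σ ξ (x i, interfAt α b {i}ᶜ x q)) (hpm b)).symm

/-- Tonelli turns the mean count into a sum over nodes, and `sum_map_loc_interf` turns that sum into
an integral against a product measure. -/
lemma meanDiscovered_eq (hN : N.IsRandomHello P lam ρ ms mi) (hms : 0 < ms) (hmi : 0 < mi)
    (hlam : 0 < lam) (hρ : 0 < ρ) {α : ℝ} (hα : 2 < α) (σ ξ : ℝ) :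
    N.meanDiscovered P α σ ξ = ENNReal.ofReal (1 - ρ) *
      ∑ b : Fin M, ENNReal.ofReal ρ * (M : ℝ≥0∞)⁻¹ * ∫⁻ x, ∫⁻ t, decodeProb ms α σ ξ (x, t)
        ∂hN.interfLaw α b ∂(ENNReal.ofReal lam • (volume : Measure Plane)) := by
  have hH := measurable_decodeProb hms α σ ξ
  rw [meanDiscovered]
  simp_rw [discovered_eq_tsum]
  rw [lintegral_tsum fun i => (measurable_one.indicator
    (hN.measurableSet_discoverEvent α σ ξ i)).aemeasurable]
  simp_rw [lintegral_indicator_one (hN.measurableSet_discoverEvent α σ ξ _),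
    hN.measure_discoverEvent hms hρ]
  rw [ENNReal.tsum_mul_left, Summable.tsum_finsetSum fun _ _ => ENNReal.summable]
  congr 1
  refine Finset.sum_congr rfl fun b _ => ?_
  have := hN.isProbabilityMeasure_interfLaw α b
  rw [ENNReal.tsum_mul_left, ← lintegral_prod _ hH.aemeasurable,
    ← hN.sum_map_loc_interf hmi hlam hρ hα b, lintegral_sum_measure]
  congr 1
  refine tsum_congr fun i => (lintegral_map hH ?_).symm
  exact (hN.loc_poisson.measurable i).prodMk (hN.measurable_interfAt_comp α b {i}ᶜ)

end IsRandomHello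
end Slot

/-! ### From the Erlang tail to derivatives and radial integrals. -/

lemma decodeProb_eq {m : ℕ} (hm : 0 < m) {α ξ : ℝ} (σ : ℝ) (hξ : 0 < ξ) {x : Plane}
    (hx : x ≠ 0) {t : ℝ≥0∞} (ht : t ≠ ∞) :
    decodeProb m α σ ξ (x, t)
      = ENNReal.ofReal (erlangTail m (m * ξ * ‖x‖ ^ α * (t.toReal + σ ^ 2))) := by
  have hm' : (0 : ℝ) < m := by exact_mod_cast hm
  have hx' : 0 < ‖x‖ := norm_pos_iff.2 hx
  have hxα : 0 < ‖x‖ ^ α := Real.rpow_pos_of_pos hx' α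
  have ht0 : 0 ≤ t.toReal := ENNReal.toReal_nonneg
  have hset : Prod.mk (x, t) ⁻¹' decodeSet α σ ξ
      = Set.Ioi (ξ * ‖x‖ ^ α * (t.toReal + σ ^ 2)) := by
    ext a
    simp only [Set.mem_preimage, decodeSet, Set.mem_ofPred_eq, Set.mem_Ioi]
    -- The denominator may vanish if `σ = 0`; cross-multiplication remains valid because `0 < ξ <
    -- ∞`.
    rw [ENNReal.lt_div_iff_mul_lt (Or.inr (by simp)) (Or.inr (by simpa using hξ)), Slot.power,
      ← ofReal_norm, ENNReal.ofReal_rpow_of_pos hx']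
    nth_rw 1 [← ENNReal.ofReal_toReal ht]
    rw [← ENNReal.ofReal_add ht0 (sq_nonneg σ), ← ENNReal.ofReal_mul hξ.le,
      ← ENNReal.ofReal_mul (by positivity),
      ENNReal.ofReal_lt_ofReal_iff_of_nonneg (by positivity), Real.rpow_neg hx'.le,
      inv_mul_eq_div, lt_div_iff₀ hxα, mul_right_comm]
  rw [decodeProb, hset, gammaMeasure_Ioi hm hm' (by positivity)]
  congr 2
  ring

lemma interfExponent_nonneg {lam ρ α ζ : ℝ} {M mi : ℕ} (hlam : 0 < lam) (hρ : 0 < ρ)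
    (hmi : 0 < mi) (hα : 2 < α) (hζ : 0 ≤ ζ) : 0 ≤ interfExponent lam ρ M mi α ζ := by
  have := DeltaI_pos hmi hα
  unfold interfExponent
  positivity

lemma expTerm_eq (lam ρ : ℝ) (M mi : ℕ) (α σ ζ : ℝ) :
    expTerm lam ρ M mi α σ ζ
      = Real.exp (-interfExponent lam ρ M mi α ζ) * Real.exp (-(ζ * σ ^ 2)) := by
  rw [expTerm, interfExponent, ← Real.exp_add]
  congr 1
  ring

section InterferenceLaw

variable {lam ρ α σ ξ : ℝ} {M ms mi : ℕ} {κ : Measure ℝ≥0∞} [IsProbabilityMeasure κ]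

/-- For `ζ > 0` the Laplace transform is at most the mass of the finite values, and it tends to `1`
as `ζ` decreases to `0`. -/
lemma ae_ne_top_of_laplace (hα : 2 < α)
    (hκ : ∀ ζ, 0 ≤ ζ → ∫⁻ t, expNeg (ENNReal.ofReal ζ * t) ∂κ
      = expNeg (ENNReal.ofReal (interfExponent lam ρ M mi α ζ))) : ∀ᵐ t ∂κ, t ≠ ∞ := by
  have h1 : Tendsto (fun ζ => expNeg (ENNReal.ofReal (interfExponent lam ρ M mi α ζ)))
      (𝓝[>] 0) (𝓝 1) := by
    have hc : Continuous fun ζ => expNeg (ENNReal.ofReal (interfExponent lam ρ M mi α ζ)) := by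
      refine continuous_expNeg.comp (ENNReal.continuous_ofReal.comp ?_)
      unfold interfExponent
      have := Real.continuous_rpow_const (q := 2 / α) (by positivity)
      fun_prop
    have h0 : expNeg (ENNReal.ofReal (interfExponent lam ρ M mi α 0)) = 1 := by
      have : 2 / α ≠ 0 := by positivity
      simp [interfExponent, Real.zero_rpow this]
    rw [← h0]
    exact (hc.tendsto 0).mono_left nhdsWithin_le_nhds
  have h2 : (1 : ℝ≥0∞) ≤ κ {t | t ≠ ∞} := by
    refine le_of_tendsto h1 ?_
    filter_upwards [self_mem_nhdsWithin] with ζ hζ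
    have hζ : 0 < ζ := hζ
    have hm : MeasurableSet {t : ℝ≥0∞ | t ≠ ∞} := (measurableSet_singleton ∞).compl
    rw [← hκ ζ hζ.le, ← lintegral_indicator_one hm]
    refine lintegral_mono fun t => ?_
    by_cases ht : t = ∞
    · simp [ht, ENNReal.mul_top, hζ]
    · simp [ht, expNeg_le_one]
  exact (prob_compl_eq_zero_iff (measurableSet_singleton ∞).compl).2 (le_antisymm prob_le_one h2)

/-- The integrand is at most `k! / ζ ^ k`, since one term of the exponential series is bounded by
its sum. -/
lemma integrable_pow_mul_exp (k : ℕ) (σ : ℝ) {ζ : ℝ} (hζ : 0 < ζ) :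
    Integrable (fun t : ℝ≥0∞ => (t.toReal + σ ^ 2) ^ k * Real.exp (-(ζ * (t.toReal + σ ^ 2)))) κ := by
  refine Integrable.of_bound (C := k.factorial / ζ ^ k)
    (Measurable.aestronglyMeasurable (by fun_prop)) (ae_of_all _ fun t => ?_)
  have hW : 0 ≤ t.toReal + σ ^ 2 := by positivity
  rw [Real.norm_eq_abs, abs_of_nonneg (by positivity), Real.exp_neg, ← div_eq_mul_inv,
    div_le_div_iff₀ (Real.exp_pos _) (by positivity), ← mul_pow]
  have h := Real.pow_div_factorial_le_exp (ζ * (t.toReal + σ ^ 2)) (by positivity) k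
  rw [div_le_iff₀ (by positivity)] at h
  rw [mul_comm _ ζ, mul_comm (k.factorial : ℝ)]
  exact h

lemma integral_exp_interf (hlam : 0 < lam) (hρ : 0 < ρ) (hmi : 0 < mi) (hα : 2 < α)
    (hκ : ∀ ζ, 0 ≤ ζ → ∫⁻ t, expNeg (ENNReal.ofReal ζ * t) ∂κ
      = expNeg (ENNReal.ofReal (interfExponent lam ρ M mi α ζ))) {ζ : ℝ} (hζ : 0 ≤ ζ) :
    ∫ t, Real.exp (-(ζ * (t.toReal + σ ^ 2))) ∂κ = expTerm lam ρ M mi α σ ζ := by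
  have h1 : ∫ t, Real.exp (-(ζ * t.toReal)) ∂κ
      = Real.exp (-interfExponent lam ρ M mi α ζ) := by
    rw [integral_eq_lintegral_of_nonneg_ae (ae_of_all _ fun t => (Real.exp_pos _).le)
      (Measurable.aestronglyMeasurable (by fun_prop))]
    have h2 : ∫⁻ t, ENNReal.ofReal (Real.exp (-(ζ * t.toReal))) ∂κ
        = ∫⁻ t, expNeg (ENNReal.ofReal ζ * t) ∂κ := by
      refine lintegral_congr_ae ?_
      filter_upwards [ae_ne_top_of_laplace hα hκ] with t ht
      nth_rw 2 [← ENNReal.ofReal_toReal ht]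
      rw [← ENNReal.ofReal_mul hζ, expNeg_ofReal (by positivity)]
    rw [h2, hκ ζ hζ, expNeg_ofReal (interfExponent_nonneg hlam hρ hmi hα hζ),
      ENNReal.toReal_ofReal (Real.exp_pos _).le]
  rw [expTerm_eq, ← h1, ← integral_mul_const]
  congr 1
  ext t
  rw [← Real.exp_add]
  congr 1
  ring

/-- Near `ζ > 0`, `expTerm` is the moment generating function of minus interference plus noise, `Y =
-(t + σ ^ 2)`. Its domain contains `(0, ∞)`, so it may be differentiated under the integral there.
-/
lemma iteratedDeriv_expTerm (hlam : 0 < lam) (hρ : 0 < ρ) (hmi : 0 < mi) (hα : 2 < α)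
    (hκ : ∀ ζ, 0 ≤ ζ → ∫⁻ t, expNeg (ENNReal.ofReal ζ * t) ∂κ
      = expNeg (ENNReal.ofReal (interfExponent lam ρ M mi α ζ))) (k : ℕ) {ζ : ℝ} (hζ : 0 < ζ) :
    iteratedDeriv k (expTerm lam ρ M mi α σ) ζ
      = (-1) ^ k * ∫ t, (t.toReal + σ ^ 2) ^ k * Real.exp (-(ζ * (t.toReal + σ ^ 2))) ∂κ := by
  set Y : ℝ≥0∞ → ℝ := fun t => -(t.toReal + σ ^ 2) with hY
  have hsub : Set.Ioi 0 ⊆ integrableExpSet Y κ := fun z hz => by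
    have h := integrable_pow_mul_exp (κ := κ) 0 σ hz
    simpa [integrableExpSet, hY, neg_add, mul_add] using h
  have hint : ζ ∈ interior (integrableExpSet Y κ) :=
    interior_maximal hsub isOpen_Ioi hζ
  have heq : expTerm lam ρ M mi α σ =ᶠ[𝓝 ζ] mgf Y κ := by
    filter_upwards [Ioi_mem_nhds hζ] with z hz
    rw [← integral_exp_interf (σ := σ) hlam hρ hmi hα hκ (le_of_lt hz), mgf]
    simp only [hY, mul_neg]
  rw [heq.iteratedDeriv_eq, iteratedDeriv_mgf hint, ← integral_const_mul]
  congr 1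
  ext t
  simp only [hY]
  rw [neg_pow, mul_neg, mul_assoc]

lemma integrand_eq (hlam : 0 < lam) (hρ : 0 < ρ) (hms : 0 < ms) (hmi : 0 < mi) (hα : 2 < α)
    (hξ : 0 < ξ) (hκ : ∀ ζ, 0 ≤ ζ → ∫⁻ t, expNeg (ENNReal.ofReal ζ * t) ∂κ
      = expNeg (ENNReal.ofReal (interfExponent lam ρ M mi α ζ))) (k : ℕ) {r : ℝ} (hr : 0 < r) :
    integrand lam ρ M ms mi α σ ξ k r = r ^ (k * α + 1) * ((-1) ^ k *
      ∫ t, (t.toReal + σ ^ 2) ^ k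
        * Real.exp (-(ms * ξ * r ^ α * (t.toReal + σ ^ 2))) ∂κ) := by
  have hms' : (0 : ℝ) < ms := by exact_mod_cast hms
  rw [integrand, iteratedDeriv_expTerm hlam hρ hmi hα hκ k (by positivity)]

/-- The sign `(-1) ^ k` of the derivative cancels that of `(-(ms ξ)) ^ k`. The power `r ^ (k α)`
comes from `(ms ξ r ^ α) ^ k`, and the extra `r` is the polar Jacobian. -/
lemma mul_integral_erlangTail (hlam : 0 < lam) (hρ : 0 < ρ) (hms : 0 < ms) (hmi : 0 < mi)
    (hα : 2 < α) (hξ : 0 < ξ) (hκ : ∀ ζ, 0 ≤ ζ → ∫⁻ t, expNeg (ENNReal.ofReal ζ * t) ∂κ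
      = expNeg (ENNReal.ofReal (interfExponent lam ρ M mi α ζ))) {r : ℝ} (hr : 0 < r) :
    Integrable (fun t : ℝ≥0∞ => erlangTail ms (ms * ξ * r ^ α * (t.toReal + σ ^ 2))) κ ∧
    r * ∫ t, erlangTail ms (ms * ξ * r ^ α * (t.toReal + σ ^ 2)) ∂κ
      = ∑ k ∈ Finset.range ms, (-(ms * ξ)) ^ k / (k.factorial : ℝ)
          * integrand lam ρ M ms mi α σ ξ k r := by
  have hms' : (0 : ℝ) < ms := by exact_mod_cast hms
  have hζ : 0 < ms * ξ * r ^ α := by positivity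
  have h1 (t : ℝ≥0∞) : erlangTail ms (ms * ξ * r ^ α * (t.toReal + σ ^ 2))
      = ∑ k ∈ Finset.range ms, (ms * ξ * r ^ α) ^ k / (k.factorial : ℝ)
        * ((t.toReal + σ ^ 2) ^ k * Real.exp (-(ms * ξ * r ^ α * (t.toReal + σ ^ 2)))) := by
    rw [erlangTail, Finset.mul_sum]
    refine Finset.sum_congr rfl fun k _ => ?_
    rw [mul_pow (ms * ξ * r ^ α)]
    ring
  have hi (k : ℕ) := (integrable_pow_mul_exp (κ := κ) k σ hζ).const_mul
    ((ms * ξ * r ^ α) ^ k / (k.factorial : ℝ))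
  simp_rw [h1]
  refine ⟨integrable_finsetSum _ fun k _ => hi k, ?_⟩
  rw [integral_finsetSum _ fun k _ => hi k, Finset.mul_sum]
  refine Finset.sum_congr rfl fun k _ => ?_
  rw [integral_const_mul, integrand_eq hlam hρ hms hmi hα hξ hκ k hr, Real.rpow_add hr,
    Real.rpow_one, mul_comm (k : ℝ) α, Real.rpow_mul hr.le, Real.rpow_natCast, neg_pow (ms * ξ),
    mul_pow (ms * ξ)]
  have h2 : ((-1 : ℝ) ^ k) * (-1) ^ k = 1 := by rw [← mul_pow]; simp
  linear_combination (-(r * (r ^ α) ^ k * (ms * ξ) ^ k / (k.factorial : ℝ) *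
    ∫ t, (t.toReal + σ ^ 2) ^ k * Real.exp (-(ms * ξ * r ^ α * (t.toReal + σ ^ 2))) ∂κ)) * h2

/-- Half of the exponential absorbs the power: `W ^ k exp (-ζ W) ≤ k! (2/ζ) ^ k exp (-ζ W / 2)`. At
`ζ / 2` the interference exponent equals `c r ^ 2`, because `(r ^ α) ^ (2/α) = r ^ 2`, and `ζ ^
(-k)` cancels `r ^ (k α)`. The bound left is `C r exp (-c r ^ 2)`. -/
lemma integrableOn_integrand (hlam : 0 < lam) (hρ : 0 < ρ) (hM : 0 < M) (hms : 0 < ms)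
    (hmi : 0 < mi) (hα : 2 < α) (hξ : 0 < ξ)
    (hκ : ∀ ζ, 0 ≤ ζ → ∫⁻ t, expNeg (ENNReal.ofReal ζ * t) ∂κ
      = expNeg (ENNReal.ofReal (interfExponent lam ρ M mi α ζ))) (k : ℕ) :
    IntegrableOn (integrand lam ρ M ms mi α σ ξ k) (Set.Ioi 0) := by
  have hms' : (0 : ℝ) < ms := by exact_mod_cast hms
  have hM' : (0 : ℝ) < M := by exact_mod_cast hM
  have hD := DeltaI_pos hmi hα
  have hα0 : 0 < α := by linarith
  set c : ℝ := lam * ρ / M * Real.pi * (ms * ξ / 2) ^ (2 / α) * DeltaI mi α with hc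
  have hc0 : 0 < c := by positivity
  set C : ℝ := k.factorial * 2 ^ k / (ms * ξ) ^ k with hC
  have hbound : IntegrableOn (fun r : ℝ => C * (r * Real.exp (-c * r ^ 2))) (Set.Ioi 0) :=
    ((integrable_mul_exp_neg_mul_sq hc0).const_mul C).integrableOn
  have hmeas : AEStronglyMeasurable (integrand lam ρ M ms mi α σ ξ k)
      (volume.restrict (Set.Ioi 0)) := by
    -- Measurability is obtained from the integral formula for the derivative, valid on `(0, ∞)`.
    have hf : StronglyMeasurable fun r : ℝ => r ^ (k * α + 1) * ((-1) ^ k *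
        ∫ t, (t.toReal + σ ^ 2) ^ k
          * Real.exp (-(ms * ξ * r ^ α * (t.toReal + σ ^ 2))) ∂κ) := by
      have h1 : StronglyMeasurable fun p : ℝ × ℝ≥0∞ => (p.2.toReal + σ ^ 2) ^ k
          * Real.exp (-(ms * ξ * p.1 ^ α * (p.2.toReal + σ ^ 2))) :=
        Measurable.stronglyMeasurable (by fun_prop)
      exact (Measurable.stronglyMeasurable (by fun_prop)).mul
        (stronglyMeasurable_const.mul h1.integral_prod_right)
    refine hf.aestronglyMeasurable.congr ?_
    filter_upwards [ae_restrict_mem measurableSet_Ioi] with r hr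
    exact (integrand_eq hlam hρ hms hmi hα hξ hκ k hr).symm
  refine hbound.mono' hmeas ?_
  filter_upwards [ae_restrict_mem measurableSet_Ioi] with r hr
  have hr : 0 < r := hr
  have hζ : 0 < ms * ξ * r ^ α := by positivity
  set ζ := ms * ξ * r ^ α with hζdef
  have hI : ∫ t, (t.toReal + σ ^ 2) ^ k * Real.exp (-(ζ * (t.toReal + σ ^ 2))) ∂κ
      ≤ k.factorial * 2 ^ k / ζ ^ k * expTerm lam ρ M mi α σ (ζ / 2) := by
    have hint0 := integrable_pow_mul_exp (κ := κ) 0 σ (half_pos hζ)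
    simp only [pow_zero, one_mul] at hint0
    rw [← integral_exp_interf hlam hρ hmi hα hκ (half_pos hζ).le, ← integral_const_mul]
    refine integral_mono (integrable_pow_mul_exp k σ hζ) (hint0.const_mul _) fun t => ?_
    set W := t.toReal + σ ^ 2 with hW
    have hW0 : 0 ≤ W := by positivity
    have h := Real.pow_div_factorial_le_exp (ζ / 2 * W) (by positivity) k
    rw [div_le_iff₀ (by positivity)] at h
    have h2 : W ^ k = (ζ / 2 * W) ^ k * (2 ^ k / ζ ^ k) := by
      rw [← div_pow, ← mul_pow]
      congr 1
      field_simp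
    have h3 : Real.exp (-(ζ * W)) = Real.exp (-(ζ / 2 * W)) * Real.exp (-(ζ / 2 * W)) := by
      rw [← Real.exp_add]
      congr 1
      ring
    have h4 : Real.exp (ζ / 2 * W) * Real.exp (-(ζ / 2 * W)) = 1 := by
      rw [← Real.exp_add]; simp
    calc W ^ k * Real.exp (-(ζ * W))
        ≤ (Real.exp (ζ / 2 * W) * k.factorial * (2 ^ k / ζ ^ k)) * Real.exp (-(ζ * W)) := by
          rw [h2]
          gcongr
      _ = _ := by
          rw [h3]
          linear_combination (k.factorial * (2 ^ k / ζ ^ k) * Real.exp (-(ζ / 2 * W))) * h4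
  have hI0 : 0 ≤ ∫ t, (t.toReal + σ ^ 2) ^ k * Real.exp (-(ζ * (t.toReal + σ ^ 2))) ∂κ :=
    integral_nonneg fun t => by
      have : 0 ≤ t.toReal := ENNReal.toReal_nonneg
      positivity
  have hE : expTerm lam ρ M mi α σ (ζ / 2) ≤ Real.exp (-c * r ^ 2) := by
    rw [expTerm_eq]
    have h1 : interfExponent lam ρ M mi α (ζ / 2) = c * r ^ 2 := by
      rw [interfExponent, hζdef, hc, show ms * ξ * r ^ α / 2 = ms * ξ / 2 * r ^ α by ring,
        Real.mul_rpow (by positivity) (by positivity), ← Real.rpow_mul hr.le,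
        mul_div_cancel₀ _ hα0.ne', Real.rpow_two]
      ring
    rw [h1, neg_mul]
    refine mul_le_of_le_one_right (Real.exp_pos _).le (Real.exp_le_one_iff.2 ?_)
    have : 0 ≤ ζ / 2 * σ ^ 2 := by positivity
    linarith
  rw [integrand_eq hlam hρ hms hmi hα hξ hκ k hr, ← hζdef, norm_mul, norm_mul, norm_pow, norm_neg,
    norm_one, one_pow, one_mul, Real.norm_of_nonneg (by positivity), Real.norm_of_nonneg hI0]
  calc _ ≤ r ^ (k * α + 1) * (k.factorial * 2 ^ k / ζ ^ k * Real.exp (-c * r ^ 2)) := by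
        gcongr
        exact hI.trans (by gcongr)
    _ = _ := by
        rw [Real.rpow_add hr, Real.rpow_one, mul_comm (k : ℝ) α, Real.rpow_mul hr.le,
          Real.rpow_natCast, hζdef, hC, mul_pow (ms * ξ)]
        have : r ^ α ≠ 0 := (Real.rpow_pos_of_pos hr α).ne'
        field_simp

/-- The averaged decoding probability is radial, and the factor `2π` is the dimension times the area
of the unit disc. The nonnegativity, inherited from the Erlang tail, is recorded for the later
passage from `ENNReal.ofReal` back to reals. -/
lemma lintegral_decodeProb (hlam : 0 < lam) (hρ : 0 < ρ) (hM : 0 < M) (hms : 0 < ms)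
    (hmi : 0 < mi) (hα : 2 < α) (hξ : 0 < ξ)
    (hκ : ∀ ζ, 0 ≤ ζ → ∫⁻ t, expNeg (ENNReal.ofReal ζ * t) ∂κ
      = expNeg (ENNReal.ofReal (interfExponent lam ρ M mi α ζ))) :
    0 ≤ ∑ k ∈ Finset.range ms, (-(ms * ξ)) ^ k / (k.factorial : ℝ)
          * ∫ r in Set.Ioi (0 : ℝ), integrand lam ρ M ms mi α σ ξ k r ∧
    ∫⁻ x, ∫⁻ t, decodeProb ms α σ ξ (x, t) ∂κ ∂(volume : Measure Plane)
      = ENNReal.ofReal (2 * Real.pi * ∑ k ∈ Finset.range ms,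
          (-(ms * ξ)) ^ k / (k.factorial : ℝ)
          * ∫ r in Set.Ioi (0 : ℝ), integrand lam ρ M ms mi α σ ξ k r) := by
  have hms' : (0 : ℝ) < ms := by exact_mod_cast hms
  set G : ℝ → ℝ := fun r => ∫ t, erlangTail ms (ms * ξ * r ^ α * (t.toReal + σ ^ 2)) ∂κ with hG
  have hterm0 {r : ℝ} (hr : 0 ≤ r) (t : ℝ≥0∞) :
      0 ≤ erlangTail ms (ms * ξ * r ^ α * (t.toReal + σ ^ 2)) := by
    have : 0 ≤ t.toReal := ENNReal.toReal_nonneg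
    exact erlangTail_nonneg _ (by positivity)
  have hG0 {r : ℝ} (hr : 0 ≤ r) : 0 ≤ G r := integral_nonneg fun t => hterm0 hr t
  have hint (k : ℕ) := integrableOn_integrand (σ := σ) hlam hρ hM hms hmi hα hξ hκ k
  have hsum : ∀ r ∈ Set.Ioi (0 : ℝ), ∑ k ∈ Finset.range ms, (-(ms * ξ)) ^ k / (k.factorial : ℝ)
      * integrand lam ρ M ms mi α σ ξ k r = r ^ (Module.finrank ℝ Plane - 1) • G r := by
    intro r hr
    rw [← (mul_integral_erlangTail hlam hρ hms hmi hα hξ hκ hr).2]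
    simp [hG]
  have hGint : IntegrableOn (fun r => r ^ (Module.finrank ℝ Plane - 1) • G r) (Set.Ioi 0) :=
    IntegrableOn.congr_fun (integrable_finsetSum _ fun k _ => (hint k).const_mul _) hsum
      measurableSet_Ioi
  have hGval : ∫ r in Set.Ioi (0 : ℝ), r ^ (Module.finrank ℝ Plane - 1) • G r
      = ∑ k ∈ Finset.range ms, (-(ms * ξ)) ^ k / (k.factorial : ℝ)
          * ∫ r in Set.Ioi (0 : ℝ), integrand lam ρ M ms mi α σ ξ k r := by
    rw [← setIntegral_congr_fun measurableSet_Ioi hsum,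
      integral_finsetSum _ fun k _ => (hint k).const_mul _]
    exact Finset.sum_congr rfl fun k _ => integral_const_mul _ _
  refine ⟨?_, ?_⟩
  · rw [← hGval]
    refine setIntegral_nonneg measurableSet_Ioi fun r hr => ?_
    have hr : 0 < r := hr
    exact smul_nonneg (by positivity) (hG0 hr.le)
  have hne : ∀ᵐ x : Plane, x ≠ 0 := by simp [ae_iff]
  have h1 : ∫⁻ x, ∫⁻ t, decodeProb ms α σ ξ (x, t) ∂κ ∂(volume : Measure Plane)
      = ∫⁻ x : Plane, ENNReal.ofReal (G ‖x‖) := by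
    refine lintegral_congr_ae ?_
    filter_upwards [hne] with x hx
    have hx' : 0 < ‖x‖ := norm_pos_iff.2 hx
    rw [hG, ofReal_integral_eq_lintegral_ofReal
      (mul_integral_erlangTail hlam hρ hms hmi hα hξ hκ hx').1
      (ae_of_all _ fun t => hterm0 hx'.le t)]
    refine lintegral_congr_ae ?_
    filter_upwards [ae_ne_top_of_laplace hα hκ] with t ht
    exact decodeProb_eq hms σ hξ hx ht
  have hball : (volume : Measure Plane).real (Metric.ball 0 1) = Real.pi := by
    rw [measureReal_def, EuclideanSpace.volume_ball_fin_two]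
    simp [Real.pi_pos.le]
  rw [h1, ← ofReal_integral_eq_lintegral_ofReal
    ((integrable_fun_norm_addHaar (volume : Measure Plane)).2 hGint)
    (ae_of_all _ fun x => hG0 (norm_nonneg x)),
    integral_fun_norm_addHaar, hGval, hball]
  congr 1
  simp [mul_assoc]

end InterferenceLaw

end PeerDiscovery

end

theorem lemma1 {Ω : Type*} [MeasurableSpace Ω] (P : Measure Ω) [IsProbabilityMeasure P]
    (M ms mi : ℕ) (hM : 0 < M) (hms : 0 < ms) (hmi : 0 < mi)
    (lam ρ α σ ξ : ℝ) (hlam : 0 < lam) (hρ : 0 < ρ) (hρ1 : ρ ≤ 1) (hα : 2 < α) (hξ : 0 < ξ)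
    (N : PeerDiscovery.Slot Ω M) (hN : N.IsRandomHello P lam ρ ms mi) :
    AEMeasurable (N.discovered α σ ξ) P ∧
    N.meanDiscovered P α σ ξ ≠ ∞ ∧
    (∀ k ∈ Finset.range ms,
      IntegrableOn (PeerDiscovery.integrand lam ρ M ms mi α σ ξ k) (Set.Ioi 0)) ∧
    (N.meanDiscovered P α σ ξ).toReal =
      2 * Real.pi * lam * ρ * (1 - ρ) *
        ∑ k ∈ Finset.range ms, (-(ms * ξ)) ^ k / (k.factorial : ℝ) *
          ∫ r in Set.Ioi (0 : ℝ), PeerDiscovery.integrand lam ρ M ms mi α σ ξ k r := by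
  have hκ (b : Fin M) (ζ : ℝ) (hζ : 0 ≤ ζ) := hN.laplace_interfLaw hmi hlam hρ hα b hζ
  have hprob (b : Fin M) := hN.isProbabilityMeasure_interfLaw α b
  have hdec (b : Fin M) := PeerDiscovery.lintegral_decodeProb (σ := σ) (ms := ms) (ξ := ξ)
    hlam hρ hM hms hmi hα hξ (hκ b)
  have hnonneg := (hdec ⟨0, hM⟩).1
  have hM0 : (M : ℝ≥0∞) ≠ 0 := by exact_mod_cast hM.ne'
  have hmean := hN.meanDiscovered_eq hms hmi hlam hρ hα σ ξ
  simp_rw [lintegral_smul_measure, (hdec _).2, Finset.sum_const, Finset.card_univ,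
    Fintype.card_fin, nsmul_eq_mul, ← mul_assoc] at hmean
  set S : ℝ := ∑ k ∈ Finset.range ms, (-(ms * ξ)) ^ k / (k.factorial : ℝ) *
    ∫ r in Set.Ioi (0 : ℝ), PeerDiscovery.integrand lam ρ M ms mi α σ ξ k r with hS
  have hval : N.meanDiscovered P α σ ξ
      = ENNReal.ofReal (2 * Real.pi * lam * ρ * (1 - ρ) * S) := by
    have h1 : 0 ≤ 1 - ρ := by linarith
    -- The spatial integral has the same value for each of the `M` blocks, so the sum over blocks
    -- cancels the probability `1 / M` of the desired node's block.
    rw [hmean, mul_assoc (ENNReal.ofReal (1 - ρ)), mul_comm (M : ℝ≥0∞),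
      ← mul_assoc (ENNReal.ofReal (1 - ρ)), mul_assoc _ (M : ℝ≥0∞), ENNReal.mul_inv_cancel hM0
      (by simp), mul_one, smul_eq_mul, ← ENNReal.ofReal_mul h1, ← ENNReal.ofReal_mul hlam.le,
      ← ENNReal.ofReal_mul (by positivity)]
    congr 1
    ring
  refine ⟨(hN.measurable_discovered α σ ξ).aemeasurable, ?_, fun k _ =>
    PeerDiscovery.integrableOn_integrand hlam hρ hM hms hmi hα hξ (hκ ⟨0, hM⟩) k, ?_⟩
  · rw [hval]
    exact ENNReal.ofReal_ne_top
  · have h1 : 0 ≤ 1 - ρ := by linarith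
    rw [hval, ENNReal.toReal_ofReal (by positivity)]
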